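/- Let $K\ge 1$, let $T,H,\beta_0,\sigma^2,P>0$ and $0<\eta\le 1$, and let $w_1,\dots,w_K\in\mathbb R^2$ be the users' horizontal locations. Put $h_k(q)=\beta_0/(\|q-w_k\|^2+H^2)$ for $q\in\mathbb R^2$ and $\gamma=\beta_0/\sigma^2$. A schedule consists of functions of $t\in(0,T]$: mode indicators $\rho_0,\rho_1,\dots,\rho_K$, powers $Q_1,\dots,Q_K$ and a UAV location $q$ in $\mathbb R^2$. It is admissible if these functions are measurable, $\rho_i(t)\in\{0,1\}$, $\sum_{i=0}^K\rho_i(t)=1$ and $Q_k(t)\ge 0$ for all $t\in(0,T]$, and $\int_0^T\rho_kQ_k\,dt<\infty$ for all $k$. Write $$R_k=\frac1T\int_0^T\rho_k(t)\log_2\Big(1+\frac{Q_k(t)h_k(q(t))}{\sigma^2}\Big)dt,\qquad D_k=\int_0^T\eta P\rho_0(t)h_k(q(t))\,dt-\int_0^T\rho_k(t)Q_k(t)\,dt .$$ Problem (P2) is to maximize $\min_kR_k$ over the admissible schedules with $D_k\ge 0$ for all $k$ (there is no constraint on the speed of the UAV). Its equivalent form (P2.1) is to maximize $R$ over all pairs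 of such a schedule and an $R\in\mathbb R$ with $R_k\ge R$ for all $k$. For $\lambda,\mu\in\mathbb R^K$, the dual function of (P2.1) is $$g(\lambda,\mu)=\sup\Big\{\Big(1-\sum_k\lambda_k\Big)R+\sum_k\lambda_kR_k+\sum_k\mu_kD_k\Big\}\in(-\infty,\infty],$$ the supremum being over all admissible schedules and all $R\in\mathbb R$. The dual problem (D2.1) is to minimize $g(\lambda,\mu)$ subject to $\sum_k\lambda_k=1$, $\lambda_k\ge0$, $\mu_k\ge 0$ for all $k$. Then (D2.1) has an optimal solution. Let $(\lambda^{\rm opt},\mu^{\rm opt})$ be any optimal solution of (D2.1). Then $\mu_k^{\rm opt}>0$ for all $k$, and the set of global maximizers over $\mathbb R^2$ of $$\phi(q,\mu^{\rm opt})=\sum_{k=1}^K\eta P\mu_k^{\rm opt}h_k(q)$$ is finite and nonempty. Let $\bar q_1,\dots,\bar q_\Omega$ be its distinct elements, in any order, and put $\bar Q_k=\Big(\dfrac{\lambda_k^{\rm opt}}{T\mu_k^{\rm opt}\ln2}-\dfrac{H^2}{\gamma}\Big)^+$. The linear program (P2.2) $$\max_{\varsigma_k\ge0,\ \tau_\omega\ge0,\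 R\in\mathbb R}\ R\quad\text{s.t.}\quad \frac{\varsigma_k}{T}\log_2\Big(1+\frac{\bar Q_kh_k(w_k)}{\sigma^2}\Big)\ge R,\quad \varsigma_k\bar Q_k\le\sum_{\omega=1}^\Omega\tau_\omega\eta Ph_k(\bar q_\omega)\quad\forall k,\qquad \sum_{k=1}^K\varsigma_k+\sum_{\omega=1}^\Omega\tau_\omega=T$$ has an optimal solution. For any optimal solution $(\hat\varsigma,\hat\tau,\hat R)$ of (P2.2), there is a schedule on $(0,T]$ with the following properties, and every such schedule, together with $R=\hat R$, is optimal for (P2.1): * for $\omega=1,\dots,\Omega$ and $t\in\big(\sum_{j<\omega}\hat\tau_j,\sum_{j\le\omega}\hat\tau_j\big]$: $q(t)=\bar q_\omega$, $\rho_0(t)=1$, and $\rho_k(t)=Q_k(t)=0$ for all $k$; * for $k=1,\dots,K$ and $t\in\big(\sum_\omega\hat\tau_\omega+\sum_{j<k}\hat\varsigma_j,\ \sum_\omega\hat\tau_\omega+\sum_{j\le k}\hat\varsigma_j\big]$: $q(t)=w_k$, $\rho_k(t)=1$, $Q_k(t)=\bar Q_k$, $\rho_0(t)=0$, and $\rho_j(t)=Q_j(t)=0$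 for all $j\ne k$. Such a schedule is also optimal for (P2), and its common throughput $\min_kR_k$, the optimal common throughput, equals $\hat R$. -/

import Mathlib

open MeasureTheory

noncomputable section

namespace UAV

/-- The horizontal plane with its Euclidean norm. -/
abbrev Plane : Type := EuclideanSpace ℝ (Fin 2)

/-- The parameters of a UAV-enabled wireless powered communication network with `K` ground users:
period `T`, altitude `H`, reference channel gain `β₀`, noise power `σsq` (that is `σ²`), conversion
efficiency `η`, downlink transmit power `P`, and horizontal user locations `w k`. -/
structure Network (K : ℕ) where
  T : ℝ
  H : ℝ
  β₀ : ℝ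
  σsq : ℝ
  η : ℝ
  P : ℝ
  w : Fin K → Plane
  T_pos : 0 < T
  H_pos : 0 < H
  β₀_pos : 0 < β₀
  σsq_pos : 0 < σsq
  η_pos : 0 < η
  η_le_one : η ≤ 1
  P_pos : 0 < P

/-- The decision variables as functions of time: mode indicators `ρ` (index `0` is downlink power
transfer, index `k.succ` is the uplink of user `k`), transmit powers `Q`, and UAV location `q`. -/
structure Schedule (K : ℕ) where
  ρ : Fin (K + 1) → ℝ → ℝ
  Q : Fin K → ℝ → ℝ
  q : ℝ → Plane

namespace Network

variable {K : ℕ} (N : Network K)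

/-- Lebesgue measure on the flight period `(0, T]`. -/
def periodMeasure : Measure ℝ := volume.restrict (Set.Ioc 0 N.T)

/-- Channel power gain `h_k(q)`. -/
def gain (k : Fin K) (q : Plane) : ℝ := N.β₀ / (‖q - N.w k‖ ^ 2 + N.H ^ 2)

/-- Reference signal-to-noise ratio `γ`. -/
def snr : ℝ := N.β₀ / N.σsq

/-- Harvested power `E_k(ρ₀, q)`. -/
def harvest (k : Fin K) (ρ₀ : ℝ) (q : Plane) : ℝ := N.η * N.P * ρ₀ * N.gain k q

/-- Achievable rate `r_k(ρ_k, q, Q_k)`. -/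
def rate (k : Fin K) (ρk : ℝ) (q : Plane) (Qk : ℝ) : ℝ :=
  ρk * Real.logb 2 (1 + Qk * N.gain k q / N.σsq)

/-- Total harvested energy of user `k` over the period. -/
def harvestedEnergy (s : Schedule K) (k : Fin K) : ℝ :=
  ∫ t, N.harvest k (s.ρ 0 t) (s.q t) ∂N.periodMeasure

/-- Total energy consumption of user `k` over the period. -/
def consumedEnergy (s : Schedule K) (k : Fin K) : ℝ :=
  ∫ t, s.ρ k.succ t * s.Q k t ∂N.periodMeasure

/-- Throughput `R_k` of user `k`. -/
def throughput (s : Schedule K) (k : Fin K) : ℝ :=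
  1 / N.T * ∫ t, N.rate k (s.ρ k.succ t) (s.q t) (s.Q k t) ∂N.periodMeasure

/-- The uplink common throughput `min_k R_k`. -/
def commonThroughput (s : Schedule K) : ℝ := ⨅ k, N.throughput s k

/-- The constraints on a schedule other than energy neutrality: binary modes that sum to one and
nonnegative powers at all times of the period. The variables are measurable on the period, and the
consumed energies are finite, so that all the integrals above are genuine. -/
structure Admissible (s : Schedule K) : Prop where
  binary : ∀ i, ∀ t ∈ Set.Ioc 0 N.T, s.ρ i t = 0 ∨ s.ρ i t = 1
  sum_eq_one : ∀ t ∈ Set.Ioc 0 N.T, ∑ i, s.ρ i t = 1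
  power_nonneg : ∀ k, ∀ t ∈ Set.Ioc 0 N.T, 0 ≤ s.Q k t
  measurable_ρ : ∀ i, AEMeasurable (s.ρ i) N.periodMeasure
  measurable_Q : ∀ k, AEMeasurable (s.Q k) N.periodMeasure
  measurable_q : AEMeasurable s.q N.periodMeasure
  integrable : ∀ k, Integrable (fun t => s.ρ k.succ t * s.Q k t) N.periodMeasure

/-- Feasibility for the speed-unconstrained problem: admissible and energy neutral. -/
def Feasible (s : Schedule K) : Prop :=
  N.Admissible s ∧ ∀ k, N.consumedEnergy s k ≤ N.harvestedEnergy s k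

/-- `s` maximizes the common throughput among all feasible schedules. -/
def IsOptimal (s : Schedule K) : Prop :=
  N.Feasible s ∧ ∀ s', N.Feasible s' → N.commonThroughput s' ≤ N.commonThroughput s

/-- Feasibility for the epigraph form with the auxiliary variable `R`. -/
def EpiFeasible (s : Schedule K) (R : ℝ) : Prop :=
  N.Feasible s ∧ ∀ k, R ≤ N.throughput s k

/-- `(s, R)` is an optimal solution of the epigraph form. -/
def IsEpiOptimal (s : Schedule K) (R : ℝ) : Prop :=
  N.EpiFeasible s R ∧ ∀ s' R', N.EpiFeasible s' R' → R' ≤ R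

/-- The partial Lagrangian of the epigraph form. -/
def lagrangian (s : Schedule K) (R : ℝ) (lam mu : Fin K → ℝ) : ℝ :=
  (1 - ∑ k, lam k) * R + ∑ k, lam k * N.throughput s k
    + ∑ k, mu k * (N.harvestedEnergy s k - N.consumedEnergy s k)

/-- The Lagrange dual function, with value `⊤` where the Lagrangian is unbounded. -/
def dual (lam mu : Fin K → ℝ) : EReal :=
  ⨆ (s : Schedule K) (_ : N.Admissible s) (R : ℝ), ((N.lagrangian s R lam mu : ℝ) : EReal)

/-- The feasible set of the dual problem. -/
def DualFeasible (lam mu : Fin K → ℝ) : Prop :=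
  ∑ k, lam k = 1 ∧ (∀ k, 0 ≤ lam k) ∧ ∀ k, 0 ≤ mu k

/-- Optimal solutions of the dual problem. -/
def IsDualOptimal (lam mu : Fin K → ℝ) : Prop :=
  DualFeasible lam mu ∧ ∀ lam' mu', DualFeasible lam' mu' → N.dual lam mu ≤ N.dual lam' mu'

/-- `φ(q, μ) = ∑ₖ η P μₖ hₖ(q)`. -/
def phi (q : Plane) (mu : Fin K → ℝ) : ℝ := ∑ k, N.η * N.P * mu k * N.gain k q

/-- The set of global maximizers of `φ(·, μ)` over the plane. -/
def maximizers (mu : Fin K → ℝ) : Set Plane := {q | ∀ q', N.phi q' mu ≤ N.phi q mu}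

/-- The uplink power `Q^(λ,μ) = (λ / (T μ ln 2) - H² / γ)⁺` (used for `μ > 0` only). -/
def power (l m : ℝ) : ℝ := max (l / (N.T * m * Real.log 2) - N.H ^ 2 / N.snr) 0

/-- Feasibility for the linear program that determines the hovering durations `τ ω` at `qbar ω` and
`ς k` above user `k`. -/
structure LPFeasible (lam mu : Fin K → ℝ) {Ω : ℕ} (qbar : Fin Ω → Plane)
    (ς : Fin K → ℝ) (τ : Fin Ω → ℝ) (R : ℝ) : Prop where
  ς_nonneg : ∀ k, 0 ≤ ς k
  τ_nonneg : ∀ ω, 0 ≤ τ ω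
  throughput_ge : ∀ k, R ≤ ς k / N.T *
    Real.logb 2 (1 + N.power (lam k) (mu k) * N.gain k (N.w k) / N.σsq)
  energy_le : ∀ k, ς k * N.power (lam k) (mu k) ≤ ∑ ω, τ ω * (N.η * N.P * N.gain k (qbar ω))
  total_time : ∑ k, ς k + ∑ ω, τ ω = N.T

/-- `(ς, τ, R)` is an optimal solution of the linear program. -/
def IsLPOptimal (lam mu : Fin K → ℝ) {Ω : ℕ} (qbar : Fin Ω → Plane)
    (ς : Fin K → ℝ) (τ : Fin Ω → ℝ) (R : ℝ) : Prop :=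
  N.LPFeasible lam mu qbar ς τ R ∧
    ∀ ς' τ' R', N.LPFeasible lam mu qbar ς' τ' R' → R' ≤ R

/-- The sub-period for downlink power transfer at the `ω`-th location. -/
def downlinkPeriod {Ω : ℕ} (τ : Fin Ω → ℝ) (ω : Fin Ω) : Set ℝ :=
  Set.Ioc (∑ j ∈ Finset.Iio ω, τ j) (∑ j ∈ Finset.Iic ω, τ j)

/-- The sub-period for the uplink of user `k`. -/
def uplinkPeriod {Ω : ℕ} (ς : Fin K → ℝ) (τ : Fin Ω → ℝ) (k : Fin K) : Set ℝ :=
  Set.Ioc (∑ ω, τ ω + ∑ j ∈ Finset.Iio k, ς j) (∑ ω, τ ω + ∑ j ∈ Finset.Iic k, ς j)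

/-- `s` is the multi-location-hovering schedule with hovering durations `τ` and `ς`. -/
structure IsHovering (lam mu : Fin K → ℝ) {Ω : ℕ} (qbar : Fin Ω → Plane)
    (ς : Fin K → ℝ) (τ : Fin Ω → ℝ) (s : Schedule K) : Prop where
  downlink : ∀ ω, ∀ t ∈ downlinkPeriod τ ω,
    s.q t = qbar ω ∧ s.ρ 0 t = 1 ∧ ∀ k : Fin K, s.ρ k.succ t = 0 ∧ s.Q k t = 0
  uplink : ∀ k, ∀ t ∈ uplinkPeriod ς τ k,
    s.q t = N.w k ∧ s.ρ k.succ t = 1 ∧ s.Q k t = N.power (lam k) (mu k) ∧ s.ρ 0 t = 0 ∧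
      ∀ j : Fin K, j ≠ k → s.ρ j.succ t = 0 ∧ s.Q j t = 0

end Network

end UAV

end

/-!
If `∑ λ = 1`, the Lagrangian is the integral over the period of the payoff, weighted by `(λ, μ)`, of
the decision taken at each time. Hence the dual function is `T` times the least upper bound `V` of
the weighted payoffs of single decisions: `φ(q, μ)` for downlink power transfer at `q`, and for the
uplink of a user, which is best served from right above, a profit maximized by water-filling.

At a dual optimum no direction `(a, b) ≥ 0` decreases `V`, so whenever every water-filling uplink
decision has `(a, b)`-payoff less than `V ∑ a`, some maximizer `q` of `φ(·, μ)` has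
`φ(q, b) ≥ V ∑ a`. By a theorem of the alternative, some time-sharing of these finitely many
decisions then attains the throughput `T V` for every user with nonnegative energy balance. This is
a feasible point of the linear program whose value is the dual bound.

The maximizers are finitely many for an algebraic reason. Identify the plane with `ℂ` and treat `z`
and `w = conj z` as independent: the value and the critical point equation make `z` a multiple root
of a polynomial whose coefficients are polynomials in `w`. At `w = ∞` its roots are the distinct
user locations, so its discriminant is not identically zero and vanishes for finitely many `w` only.
-/

namespace UAV

open Filter Topology

section Finiteness

open Polynomial

lemma finite_setOf_multiple_root {F : Type*} [Field F] [CharZero F] (G : F[X][X]) (s₀ : F)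
    (hdeg : G.natDegree ≤ (G.map (evalRingHom s₀)).natDegree)
    (hpos : 0 < (G.map (evalRingHom s₀)).natDegree)
    (hsep : (G.map (evalRingHom s₀)).Separable) :
    {s : F | ∃ z, (G.map (evalRingHom s)).eval z = 0 ∧
      (derivative (G.map (evalRingHom s))).eval z = 0}.Finite := by
  classical
  set n := (G.map (evalRingHom s₀)).natDegree with hn
  have hder : (derivative G).natDegree ≤ n - 1 :=
    (natDegree_derivative_le G).trans (Nat.sub_le_sub_right hdeg 1)
  obtain ⟨p, q, -, -, hbezout⟩ :=
    exists_mul_add_mul_eq_C_resultant G (derivative G) hdeg hder (Or.inl hpos.ne')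
  set r := G.resultant (derivative G) n (n - 1)
  have hr : r.eval s₀ ≠ 0 := by
    have hmap := resultant_map_map G (derivative G) n (n - 1) (evalRingHom s₀)
    rw [coe_evalRingHom, ← derivative_map] at hmap
    rw [← hmap]
    simpa only [natDegree_derivative, ← hn] using resultant_ne_zero _ _ hsep
  have hr0 : r ≠ 0 := fun h => hr (by rw [h, eval_zero])
  refine r.roots.toFinset.finite_toSet.subset ?_
  rintro s ⟨z, hz, hz'⟩
  have heval := congrArg (fun P : F[X][X] => (P.map (evalRingHom s)).eval z) hbezout
  simp only [Polynomial.map_add, Polynomial.map_mul, eval_add, eval_mul, ← derivative_map, hz, hz',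
    zero_mul, add_zero, Polynomial.map_C, eval_C, coe_evalRingHom] at heval
  simp [hr0, IsRoot, ← heval]

section Numerator

variable {R ι : Type*} [CommRing R] [DecidableEq ι]

/-- The numerator of `M - ∑ v ∈ S, a v / E v` over the common denominator `∏ v ∈ S, E v`. -/
noncomputable def numerator (S : Finset ι) (E : ι → R[X]) (a : ι → R) (M : R) : R[X] :=
  C M * ∏ v ∈ S, E v - ∑ v ∈ S, C (a v) * ∏ j ∈ S.erase v, E j

lemma map_numerator {R' : Type*} [CommRing R'] (f : R →+* R') (S : Finset ι) (E : ι → R[X])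
    (a : ι → R) (M : R) :
    (numerator S E a M).map f =
      numerator S (fun v => (E v).map f) (fun v => f (a v)) (f M) := by
  simp [numerator, Polynomial.map_sum, Polynomial.map_prod]

lemma natDegree_numerator_le {S : Finset ι} {E : ι → R[X]} (hE : ∀ v ∈ S, (E v).natDegree ≤ 1)
    (a : ι → R) (M : R) : (numerator S E a M).natDegree ≤ S.card := by
  have hprod : ∀ t ⊆ S, (∏ v ∈ t, E v).natDegree ≤ t.card := fun t ht =>
    (natDegree_prod_le _ _).trans <|
      (Finset.sum_le_sum fun v hv => hE v (ht hv)).trans_eq (by simp)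
  refine (natDegree_sub_le _ _).trans (max_le ?_ ?_)
  · exact (natDegree_C_mul_le _ _).trans (hprod S subset_rfl)
  · refine natDegree_sum_le_of_forall_le _ _ fun v _ => (natDegree_C_mul_le _ _).trans ?_
    exact (hprod _ (Finset.erase_subset v S)).trans (Finset.card_le_card (Finset.erase_subset v S))

variable {F : Type*} [Field F] {S : Finset ι} {E : ι → F[X]} {a : ι → F} {M z : F}

lemma eval_numerator_eq_zero (hE : ∀ v ∈ S, (E v).eval z ≠ 0)
    (hM : ∑ v ∈ S, a v / (E v).eval z = M) : (numerator S E a M).eval z = 0 := by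
  simp only [numerator, eval_sub, eval_mul, eval_C, eval_finsetSum, ← hM, Finset.sum_mul]
  refine sub_eq_zero.2 (Finset.sum_congr rfl fun v hv => ?_)
  rw [← Finset.mul_prod_erase S E hv, eval_mul]
  field_simp [hE v hv]

lemma eval_derivative_numerator_eq_zero (hE : ∀ v ∈ S, (E v).eval z ≠ 0)
    (hM : ∑ v ∈ S, a v / (E v).eval z = M)
    (hcrit : ∑ v ∈ S, a v * (derivative (E v)).eval z / (E v).eval z ^ 2 = 0) :
    (derivative (numerator S E a M)).eval z = 0 := by
  set p := ∏ v ∈ S, E v with hp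
  have herase : ∀ v ∈ S, a v * (derivative (∏ j ∈ S.erase v, E j)).eval z =
      a v / (E v).eval z * (derivative p).eval z -
        p.eval z * (a v * (derivative (E v)).eval z / (E v).eval z ^ 2) := fun v hv => by
    have := hE v hv
    rw [hp, ← Finset.mul_prod_erase S E hv, derivative_mul]
    simp only [eval_add, eval_mul]
    field_simp
    ring
  simp only [numerator, derivative_sub, derivative_C_mul, derivative_sum, eval_sub, eval_C_mul,
    eval_finsetSum]
  rw [Finset.sum_congr rfl herase, Finset.sum_sub_distrib, ← Finset.sum_mul, ← Finset.mul_sum,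
    hM, hcrit]
  ring

end Numerator

/-- The polynomial `s ((z - v)(w - conj v) + H²)` in `z` over `ℂ[s]`, where `w = 1 / s`. It
polarizes `‖z - v‖² + H²`, the case `w = conj z`; in terms of `s` the point `w = ∞` becomes
`s = 0`. -/
noncomputable def polarizedFactor (H : ℝ) (v : ℂ) : ℂ[X][X] :=
  (X - C (C v)) * C (1 - C (star v) * X) + C (C ((H : ℂ) ^ 2) * X)

section Polarized

variable (H : ℝ) (v : ℂ)

lemma natDegree_polarizedFactor_le : (polarizedFactor H v).natDegree ≤ 1 := by
  unfold polarizedFactor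
  compute_degree

lemma map_polarizedFactor (s : ℂ) : (polarizedFactor H v).map (evalRingHom s) =
    (X - C v) * C (1 - star v * s) + C ((H : ℂ) ^ 2 * s) := by
  simp [polarizedFactor]

section EvalPolarized

variable {s z : ℂ} (hs : s * star z = 1)

include hs

lemma eval_polarizedFactor : ((polarizedFactor H v).map (evalRingHom s)).eval z =
    s * (‖z - v‖ ^ 2 + H ^ 2 : ℝ) := by
  have hnorm : (‖z - v‖ : ℂ) ^ 2 = (z - v) * (star z - star v) := by
    rw [← star_sub]
    exact (Complex.mul_conj' (z - v)).symm
  rw [map_polarizedFactor]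
  push_cast
  rw [hnorm]
  simp only [eval_add, eval_mul, eval_sub, eval_X, eval_C]
  linear_combination (v - z) * hs

lemma eval_derivative_polarizedFactor :
    (derivative ((polarizedFactor H v).map (evalRingHom s))).eval z = s * star (z - v) := by
  rw [map_polarizedFactor, star_sub]
  simp only [derivative_add, derivative_mul, derivative_X_sub_C, derivative_C, mul_zero, add_zero,
    one_mul, eval_C]
  linear_combination -hs

end EvalPolarized

/-- The numerator of `M - ∑ v ∈ S, c v / (‖z - v‖² + H²)`, polarized as in `polarizedFactor`. -/
noncomputable def polarizedNumerator (S : Finset ℂ) (c : ℂ → ℝ) (H M : ℝ) : ℂ[X][X] :=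
  numerator S (polarizedFactor H) (fun v => C (c v : ℂ) * X) (C (M : ℂ))

variable (S : Finset ℂ) (c : ℂ → ℝ)

lemma map_polarizedNumerator (H M : ℝ) (s : ℂ) :
    (polarizedNumerator S c H M).map (evalRingHom s) =
      numerator S (fun v => (polarizedFactor H v).map (evalRingHom s)) (fun v => c v * s) M := by
  simp [polarizedNumerator, map_numerator]

lemma finite_multiple_root_polarizedNumerator (hS : S.Nonempty) (H : ℝ) {M : ℝ} (hM : M ≠ 0) :
    {s : ℂ | ∃ z, ((polarizedNumerator S c H M).map (evalRingHom s)).eval z = 0 ∧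
      (derivative ((polarizedNumerator S c H M).map (evalRingHom s))).eval z = 0}.Finite := by
  have hM' : (M : ℂ) ≠ 0 := by exact_mod_cast hM
  have hzero : (polarizedNumerator S c H M).map (evalRingHom 0) =
      C (M : ℂ) * ∏ v ∈ S, (X - C v) := by
    simp [map_polarizedNumerator, numerator, map_polarizedFactor]
  have hdeg : ((polarizedNumerator S c H M).map (evalRingHom 0)).natDegree = S.card := by
    rw [hzero, natDegree_C_mul hM', natDegree_prod_of_monic _ _ fun v _ => monic_X_sub_C v]
    simp
  refine finite_setOf_multiple_root _ 0
    (hdeg ▸ natDegree_numerator_le (fun v _ => natDegree_polarizedFactor_le H v) _ _)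
    (hdeg ▸ hS.card_pos) ?_
  rw [hzero]
  exact ((separable_prod_X_sub_C_iff' (f := id)).2 fun _ _ _ _ h => h).unit_mul
    (isUnit_C.2 hM'.isUnit)

lemma multiple_root_polarizedNumerator {H M : ℝ} (hH : 0 < H) {s z : ℂ} (hs : s * star z = 1)
    (hval : ∑ v ∈ S, c v / (‖z - v‖ ^ 2 + H ^ 2) = M)
    (hcrit : ∑ v ∈ S, (c v / (‖z - v‖ ^ 2 + H ^ 2) ^ 2) • (z - v) = 0) :
    ((polarizedNumerator S c H M).map (evalRingHom s)).eval z = 0 ∧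
      (derivative ((polarizedNumerator S c H M).map (evalRingHom s))).eval z = 0 := by
  have hs0 : s ≠ 0 := left_ne_zero_of_mul_eq_one hs
  have hD : ∀ v, ((‖z - v‖ ^ 2 + H ^ 2 : ℝ) : ℂ) ≠ 0 := fun v => by
    exact_mod_cast (by positivity : ‖z - v‖ ^ 2 + H ^ 2 ≠ 0)
  have hE : ∀ v ∈ S, ((polarizedFactor H v).map (evalRingHom s)).eval z ≠ 0 := fun v _ => by
    rw [eval_polarizedFactor H v hs]
    exact mul_ne_zero hs0 (hD v)
  have hval' : ∑ v ∈ S, c v * s / ((polarizedFactor H v).map (evalRingHom s)).eval z = M := by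
    rw [← hval, Complex.ofReal_sum]
    refine Finset.sum_congr rfl fun v _ => ?_
    rw [eval_polarizedFactor H v hs, mul_comm, mul_div_mul_left _ _ hs0, Complex.ofReal_div]
  have hcrit' : ∑ v ∈ S, c v * s * (derivative ((polarizedFactor H v).map (evalRingHom s))).eval z /
      ((polarizedFactor H v).map (evalRingHom s)).eval z ^ 2 = 0 := by
    have hstar : ∀ r : ℝ, star (r : ℂ) = r := Complex.conj_ofReal
    rw [← star_zero, ← hcrit, star_sum]
    refine Finset.sum_congr rfl fun v _ => ?_
    rw [eval_polarizedFactor H v hs, eval_derivative_polarizedFactor H v hs, Complex.real_smul,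
      star_mul', hstar, Complex.ofReal_div, Complex.ofReal_pow]
    have := hD v
    field_simp
  rw [map_polarizedNumerator]
  exact ⟨eval_numerator_eq_zero hE hval', eval_derivative_numerator_eq_zero hE hval' hcrit'⟩

lemma finite_critical_points {H M : ℝ} (hH : 0 < H) (hM : M ≠ 0) :
    {z : ℂ | ∑ v ∈ S, c v / (‖z - v‖ ^ 2 + H ^ 2) = M ∧
      ∑ v ∈ S, (c v / (‖z - v‖ ^ 2 + H ^ 2) ^ 2) • (z - v) = 0}.Finite := by
  rcases S.eq_empty_or_nonempty with rfl | hS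
  · simp [hM.symm]
  have hfin := finite_multiple_root_polarizedNumerator S c hS H hM
  refine ((hfin.image fun s : ℂ => star s⁻¹).union (Set.finite_singleton 0)).subset ?_
  rintro z ⟨hval, hcrit⟩
  rcases eq_or_ne z 0 with hz | hz
  · exact Or.inr hz
  have hs : (star z)⁻¹ * star z = 1 := inv_mul_cancel₀ (by simpa using hz)
  exact Or.inl ⟨(star z)⁻¹, ⟨z, multiple_root_polarizedNumerator S c hH hs hval hcrit⟩, by simp⟩

end Polarized

end Finiteness

lemma sum_smul_sub_eq_zero_of_isLocalMax {E ι : Type*} [NormedAddCommGroup E]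
    [InnerProductSpace ℝ E] (S : Finset ι) (c : ι → ℝ) (p : ι → E) {H : ℝ} (hH : 0 < H) {z : E}
    (hz : IsLocalMax (fun y => ∑ i ∈ S, c i / (‖y - p i‖ ^ 2 + H ^ 2)) z) :
    ∑ i ∈ S, (c i / (‖z - p i‖ ^ 2 + H ^ 2) ^ 2) • (z - p i) = 0 := by
  set u := ∑ i ∈ S, (c i / (‖z - p i‖ ^ 2 + H ^ 2) ^ 2) • (z - p i) with hu
  have hterm : ∀ i ∈ S, HasFDerivAt (fun y => c i / (‖y - p i‖ ^ 2 + H ^ 2))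
      ((-2 * (c i / (‖z - p i‖ ^ 2 + H ^ 2) ^ 2)) • innerSL ℝ (z - p i)) z := fun i _ => by
    have hsq := ((hasFDerivAt_id z).sub_const (p i)).norm_sq.add_const (H ^ 2)
    have hinv := (hasDerivAt_inv (by positivity : ‖z - p i‖ ^ 2 + H ^ 2 ≠ 0)).comp_hasFDerivAt z hsq
    refine (hinv.const_mul (c i)).congr_fderiv ?_
    ext y
    simp only [id_eq, map_sub, ContinuousLinearMap.comp_id, neg_smul, smul_neg,
      neg_apply, smul_apply, sub_apply, coe_innerSL_apply, nsmul_eq_mul, Nat.cast_ofNat,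
      smul_eq_mul, neg_mul, neg_inj]
    ring
  have hzero : (∑ i ∈ S, (-2 * (c i / (‖z - p i‖ ^ 2 + H ^ 2) ^ 2)) • innerSL ℝ (z - p i)) u = 0 :=
    congrArg (fun f : E →L[ℝ] ℝ => f u) (hz.hasFDerivAt_eq_zero (HasFDerivAt.fun_sum hterm))
  have hinner : -2 * inner ℝ u u = 0 := by
    rw [← hzero]
    nth_rw 1 [hu]
    simp [-map_sub, sum_inner, real_inner_smul_left, Finset.mul_sum, mul_assoc]
  simpa using hinner

section Alternative

lemma map_nonneg_of_forall_Ici_lt {E : Type*} [AddCommGroup E] [PartialOrder E]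
    [IsOrderedAddMonoid E] [Module ℝ E] [PosSMulMono ℝ E] (f : E →ₗ[ℝ] ℝ) {b x : E} {v : ℝ}
    (hv : ∀ y ∈ Set.Ici b, v < f y) (hx : 0 ≤ x) : 0 ≤ f x := by
  by_contra! hneg
  have hb : 0 ≤ (f b - v) / -f x :=
    div_nonneg (sub_nonneg.2 (hv b Set.self_mem_Ici).le) (neg_nonneg.2 hneg.le)
  have hlt := hv (b + ((f b - v) / -f x) • x) (le_add_of_nonneg_right (smul_nonneg hb hx))
  rw [map_add, map_smul, smul_eq_mul, div_mul_eq_mul_div, div_neg,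
    mul_div_cancel_right₀ _ hneg.ne] at hlt
  linarith

lemma exists_mem_stdSimplex_or_exists_dotProduct_lt {ι κ : Type*} [Fintype ι] [Fintype κ]
    (p : κ → ι → ℝ) (b : ι → ℝ) :
    (∃ θ ∈ stdSimplex ℝ κ, b ≤ ∑ j, θ j • p j) ∨
      ∃ a : ι → ℝ, 0 ≤ a ∧ ∀ j, a ⬝ᵥ p j < a ⬝ᵥ b := by
  classical
  let L : (κ → ℝ) →ₗ[ℝ] (ι → ℝ) := Fintype.linearCombination ℝ p
  by_cases hdisj : Disjoint (L '' stdSimplex ℝ κ) (Set.Ici b)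
  · obtain ⟨f, u, v, hu, huv, hv⟩ := geometric_hahn_banach_compact_closed
      ((convex_stdSimplex ℝ κ).linear_image L)
      ((isCompact_stdSimplex ℝ κ).image L.continuous_of_finiteDimensional)
      (convex_Ici b) isClosed_Ici hdisj
    obtain ⟨a, ha⟩ := (dotProductEquiv ℝ ι).surjective f.toLinearMap
    have hf : ∀ x, f x = a ⬝ᵥ x := fun x => (LinearMap.congr_fun ha x).symm
    refine Or.inr ⟨a, fun i => ?_, fun j => ?_⟩
    · have hnonneg := map_nonneg_of_forall_Ici_lt f.toLinearMap hv
        (Pi.single_nonneg.2 zero_le_one : (0 : ι → ℝ) ≤ Pi.single i 1)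
      rwa [ContinuousLinearMap.coe_coe, hf, dotProduct_single_one] at hnonneg
    · have hp : p j ∈ L '' stdSimplex ℝ κ :=
        ⟨_, single_mem_stdSimplex ℝ j, by simp [L, Fintype.linearCombination_apply_single]⟩
      rw [← hf, ← hf]
      exact (hu _ hp).trans (huv.trans (hv b Set.self_mem_Ici))
  · obtain ⟨_, ⟨θ, hθ, rfl⟩, hb⟩ := Set.not_disjoint_iff.1 hdisj
    exact Or.inl ⟨θ, hθ, hb⟩

end Alternative

section StackedIntervals

variable {ι : Type*} [LinearOrder ι] [LocallyFiniteOrderBot ι] {d : ι → ℝ}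

lemma pairwise_disjoint_stacked_Ioc (hd : ∀ i, 0 ≤ d i) (a : ℝ) :
    Pairwise (Function.onFun Disjoint fun i =>
      Set.Ioc (a + ∑ j ∈ Finset.Iio i, d j) (a + ∑ j ∈ Finset.Iic i, d j)) := by
  refine (pairwise_disjoint_on _).2 fun i j hij => Set.disjoint_left.2 fun t hi hj => ?_
  have hle : ∑ l ∈ Finset.Iic i, d l ≤ ∑ l ∈ Finset.Iio j, d l :=
    Finset.sum_le_sum_of_subset_of_nonneg
      (fun l hl => Finset.mem_Iio.2 ((Finset.mem_Iic.1 hl).trans_lt hij)) fun l _ _ => hd l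
  linarith [hi.2, hj.1]

lemma volume_real_stacked_Ioc (hd : ∀ i, 0 ≤ d i) (a : ℝ) (i : ι) :
    volume.real (Set.Ioc (a + ∑ j ∈ Finset.Iio i, d j) (a + ∑ j ∈ Finset.Iic i, d j)) = d i := by
  have hsum : ∑ j ∈ Finset.Iic i, d j = d i + ∑ j ∈ Finset.Iio i, d j := by
    rw [← Finset.Iio_insert, Finset.sum_insert (by simp)]
  rw [Real.volume_real_Ioc_of_le (by linarith [hd i]), hsum]
  ring

lemma iUnion_stacked_Ioc [Fintype ι] (hd : ∀ i, 0 ≤ d i) (a : ℝ) :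
    ⋃ i, Set.Ioc (a + ∑ j ∈ Finset.Iio i, d j) (a + ∑ j ∈ Finset.Iic i, d j) =
      Set.Ioc a (a + ∑ j, d j) := by
  refine Set.Subset.antisymm (Set.iUnion_subset fun i => Set.Ioc_subset_Ioc ?_ ?_) fun t ht => ?_
  · exact le_add_of_nonneg_right (Finset.sum_nonneg fun j _ => hd j)
  · exact add_le_add_right (Finset.sum_le_sum_of_subset_of_nonneg (Finset.subset_univ _)
      fun l _ _ => hd l) a
  have hend : ∀ s : Finset ι, a + ∑ j ∈ s, d j < t ∨ ∃ i ∈ s, t ≤ a + ∑ j ∈ Finset.Iic i, d j := by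
    intro s
    rcases s.eq_empty_or_nonempty with rfl | hs
    · exact Or.inl (by simpa using ht.1)
    · refine (lt_or_ge (a + ∑ j ∈ s, d j) t).imp_right fun hle => ⟨s.max' hs, s.max'_mem hs, ?_⟩
      refine hle.trans (add_le_add_right (Finset.sum_le_sum_of_subset_of_nonneg
        (fun l hl => Finset.mem_Iic.2 (s.le_max' l hl)) fun l _ _ => hd l) a)
  obtain ⟨i₀, -, hi₀⟩ := (hend Finset.univ).resolve_left ht.2.not_gt
  obtain ⟨i, hi, hmin⟩ := WellFounded.has_min (wellFounded_lt (α := ι))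
    {i | t ≤ a + ∑ j ∈ Finset.Iic i, d j} ⟨i₀, hi₀⟩
  refine Set.mem_iUnion.2 ⟨i, (hend (Finset.Iio i)).resolve_right ?_, hi⟩
  rintro ⟨l, hl, hle⟩
  exact hmin l hle (Finset.mem_Iio.1 hl)

end StackedIntervals

section PiecewiseConstant

variable {ι X : Type*} {s : ι → Set X}

lemma exists_eq_of_pairwise_disjoint {β : Type*} [Nonempty β]
    (hs : Pairwise (Function.onFun Disjoint s)) (c : ι → β) :
    ∃ f : X → β, ∀ i, ∀ x ∈ s i, f x = c i := by
  classical
  refine ⟨fun x => if h : ∃ i, x ∈ s i then c h.choose else Classical.arbitrary β,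
    fun i x hx => ?_⟩
  have hex : ∃ i, x ∈ s i := ⟨i, hx⟩
  simp only [dif_pos hex]
  by_contra hne
  exact Set.disjoint_left.1 (hs fun h => hne (congrArg c h)) hex.choose_spec hx

variable [MeasurableSpace X] {μ : Measure X} (hs : ∀ i, MeasurableSet (s i))

include hs

lemma aemeasurable_iUnion_of_eq_const [Countable ι] {E : Type*} [MeasurableSpace E] {f : X → E}
    {c : ι → E} (hf : ∀ i, ∀ x ∈ s i, f x = c i) : AEMeasurable f (μ.restrict (⋃ i, s i)) :=
  aemeasurable_iUnion_iff.2 fun i => aemeasurable_const.congr <|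
    (ae_restrict_mem (hs i)).mono fun x hx => (hf i x hx).symm

variable {f : X → ℝ} {c : ι → ℝ} (hμ : ∀ i, μ (s i) ≠ ⊤) (hf : ∀ i, ∀ x ∈ s i, f x = c i)

include hμ hf

lemma integrableOn_of_eq_const (i : ι) : IntegrableOn f (s i) μ :=
  (integrableOn_const (hμ i) (C := c i)).congr_fun (fun x hx => (hf i x hx).symm) (hs i)

lemma integral_iUnion_of_eq_const [Fintype ι] (hdisj : Pairwise (Function.onFun Disjoint s)) :
    ∫ x in ⋃ i, s i, f x ∂μ = ∑ i, μ.real (s i) * c i := by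
  rw [integral_iUnion_fintype hs hdisj (integrableOn_of_eq_const hs hμ hf)]
  exact Finset.sum_congr rfl fun i _ => by
    rw [setIntegral_congr_fun (hs i) (hf i), setIntegral_const, smul_eq_mul]

end PiecewiseConstant
lemma mul_log_sub_le_waterFilling {a c m Q : ℝ} (ha : 0 ≤ a) (hc : 0 < c) (hm : 0 < m)
    (hQ : 0 ≤ Q) : a * Real.log (1 + c * Q) - m * Q ≤
      a * Real.log (1 + c * max (a / m - 1 / c) 0) - m * max (a / m - 1 / c) 0 := by
  set Q₀ := max (a / m - 1 / c) 0 with hQ₀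
  have hQ₀_nonneg : 0 ≤ Q₀ := le_max_right _ _
  have hpos : 0 < 1 + c * Q₀ := by positivity
  have hconcave : Real.log (1 + c * Q) - Real.log (1 + c * Q₀) ≤ c * (Q - Q₀) / (1 + c * Q₀) := by
    rw [← Real.log_div (by positivity) hpos.ne']
    refine (Real.log_le_sub_one_of_pos (by positivity)).trans_eq ?_
    field_simp
    ring
  have hkkt : a * (c * (Q - Q₀) / (1 + c * Q₀)) ≤ m * (Q - Q₀) := by
    rw [mul_div_assoc', div_le_iff₀ hpos]
    rcases le_total (a / m - 1 / c) 0 with h | h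
    · have hslope : a * c ≤ m := by
        rw [sub_nonpos, div_le_div_iff₀ hm hc] at h
        linarith
      rw [hQ₀, max_eq_right h]
      nlinarith
    · have hslope : m * (1 + c * Q₀) = a * c := by
        rw [hQ₀, max_eq_left h]
        field_simp
        ring
      exact le_of_eq (by linear_combination (Q₀ - Q) * hslope)
  linarith [mul_le_mul_of_nonneg_left hconcave ha]

/-- The values of the decision variables at a single time; the indices of `ρ` are those of
`Schedule.ρ`. -/
structure Decision (K : ℕ) where
  ρ : Fin (K + 1) → ℝ
  Q : Fin K → ℝ
  q : Plane

/-- The decision that a schedule takes at time `t`. -/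
def Schedule.decision {K : ℕ} (s : Schedule K) (t : ℝ) : Decision K :=
  ⟨fun i => s.ρ i t, fun k => s.Q k t, s.q t⟩

/-- The schedule that always takes the decision `d`. -/
def Decision.schedule {K : ℕ} (d : Decision K) : Schedule K :=
  ⟨fun i _ => d.ρ i, fun k _ => d.Q k, fun _ => d.q⟩

lemma exists_eq_single_of_sum_eq_one {ι : Type*} [Fintype ι] [DecidableEq ι] {ρ : ι → ℝ}
    (hρ : ∀ i, ρ i = 0 ∨ ρ i = 1) (hsum : ∑ i, ρ i = 1) : ∃ i, ρ = Pi.single i 1 := by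
  have hnonneg : ∀ i, 0 ≤ ρ i := fun i => by rcases hρ i with h | h <;> simp [h]
  obtain ⟨i, hi⟩ : ∃ i, ρ i = 1 := by
    by_contra! h
    simp [fun i => (hρ i).resolve_right (h i)] at hsum
  refine ⟨i, funext fun j => ?_⟩
  rcases eq_or_ne j i with rfl | hj
  · simp [hi]
  have hpair : ρ i + ρ j ≤ 1 := hsum ▸
    Finset.add_le_sum (fun k _ => hnonneg k) (Finset.mem_univ i) (Finset.mem_univ j) hj.symm
  rw [Pi.single_eq_of_ne hj]
  linarith [hnonneg j]

namespace Network

variable {K : ℕ} (N : Network K)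

lemma gain_pos (k : Fin K) (q : Plane) : 0 < N.gain k q := by
  have := N.H_pos
  have := N.β₀_pos
  unfold gain
  positivity

lemma gain_self (k : Fin K) : N.gain k (N.w k) = N.β₀ / N.H ^ 2 := by
  simp [gain]

lemma gain_le_gain_self (k : Fin K) (q : Plane) : N.gain k q ≤ N.gain k (N.w k) := by
  have := N.H_pos
  have := N.β₀_pos
  rw [gain_self, gain]
  gcongr
  exact le_add_of_nonneg_left (sq_nonneg _)

lemma η_mul_P_pos : 0 < N.η * N.P := mul_pos N.η_pos N.P_pos

lemma continuous_gain (k : Fin K) : Continuous (N.gain k) :=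
  have := N.H_pos
  continuous_const.div (by fun_prop) fun q => by positivity

lemma tendsto_gain_cocompact (k : Fin K) : Tendsto (N.gain k) (cocompact Plane) (𝓝 0) := by
  have hnorm : Tendsto (fun q : Plane => ‖q - N.w k‖) (cocompact Plane) atTop := by
    simpa [dist_eq_norm] using tendsto_dist_right_cocompact_atTop (N.w k)
  exact (tendsto_atTop_add_const_right _ _
    ((tendsto_pow_atTop two_ne_zero).comp hnorm)).const_div_atTop _

lemma continuous_phi (mu : Fin K → ℝ) : Continuous fun q => N.phi q mu :=
  continuous_finsetSum _ fun k _ => continuous_const.mul (N.continuous_gain k)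

lemma tendsto_phi_cocompact (mu : Fin K → ℝ) :
    Tendsto (fun q => N.phi q mu) (cocompact Plane) (𝓝 0) := by
  simpa [phi] using tendsto_finsetSum Finset.univ fun k _ =>
    (N.tendsto_gain_cocompact k).const_mul (N.η * N.P * mu k)

lemma phi_pos {mu : Fin K → ℝ} (hmu : 0 ≤ mu) {j : Fin K} (hj : 0 < mu j) (q : Plane) :
    0 < N.phi q mu := by
  exact Finset.sum_pos'
    (fun k _ => mul_nonneg (mul_nonneg N.η_mul_P_pos.le (hmu k)) (N.gain_pos k q).le)
    ⟨j, Finset.mem_univ j, mul_pos (mul_pos N.η_mul_P_pos hj) (N.gain_pos j q)⟩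

lemma phi_pos_of_forall_pos [NeZero K] {mu : Fin K → ℝ} (hmu : ∀ k, 0 < mu k) (q : Plane) :
    0 < N.phi q mu :=
  N.phi_pos (fun k => (hmu k).le) (hmu 0) q

lemma exists_isMaxOn_phi {mu : Fin K → ℝ} {F : Set Plane} (hF : IsClosed F) {q₀ : Plane}
    (hq₀ : q₀ ∈ F) (hpos : 0 < N.phi q₀ mu) : ∃ q ∈ F, IsMaxOn (fun q => N.phi q mu) F q :=
  (N.continuous_phi mu).continuousOn.exists_isMaxOn' hF hq₀ <|
    (((N.tendsto_phi_cocompact mu).eventually_lt_const hpos).mono fun _ h => h.le).filter_mono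
      inf_le_left

lemma exists_phi_eq_sum_complex (e : Plane ≃ₗᵢ[ℝ] ℂ) (mu : Fin K → ℝ) :
    ∃ (S : Finset ℂ) (c : ℂ → ℝ), ∀ q,
      N.phi q mu = ∑ v ∈ S, c v / (‖e q - v‖ ^ 2 + N.H ^ 2) := by
  classical
  -- The weights of coinciding user locations add up.
  refine ⟨Finset.univ.image fun k => e (N.w k),
    fun v => ∑ k with e (N.w k) = v, N.η * N.P * mu k * N.β₀, fun q => ?_⟩
  rw [phi, ← Finset.sum_fiberwise_of_maps_to fun k hk =>
    Finset.mem_image_of_mem (fun k => e (N.w k)) hk]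
  refine Finset.sum_congr rfl fun v _ => ?_
  rw [Finset.sum_div]
  refine Finset.sum_congr rfl fun k hk => ?_
  rw [← (Finset.mem_filter.1 hk).2, ← map_sub, e.norm_map, gain, mul_div_assoc]

section Maximizers

variable {mu : Fin K → ℝ} {q₀ : Plane} (hpos : 0 < N.phi q₀ mu)

include hpos

lemma maximizers_nonempty : (N.maximizers mu).Nonempty := by
  obtain ⟨q, -, hq⟩ := N.exists_isMaxOn_phi isClosed_univ (Set.mem_univ q₀) hpos
  exact ⟨q, fun q' => hq (Set.mem_univ q')⟩

lemma maximizers_finite : (N.maximizers mu).Finite := by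
  let e : Plane ≃ₗᵢ[ℝ] ℂ := Complex.orthonormalBasisOneI.repr.symm
  obtain ⟨S, c, hphi⟩ := N.exists_phi_eq_sum_complex e mu
  obtain ⟨q₁, hq₁⟩ := N.maximizers_nonempty hpos
  have hfin := finite_critical_points S c N.H_pos (hpos.trans_le (hq₁ q₀)).ne'
  refine (hfin.preimage e.injective.injOn).subset fun q hq => ⟨?_, ?_⟩
  · rw [← hphi]
    exact le_antisymm (hq₁ q) (hq q₁)
  · refine sum_smul_sub_eq_zero_of_isLocalMax S c id N.H_pos (.of_forall fun y => ?_)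
    have := hq (e.symm y)
    rwa [hphi, hphi, e.apply_symm_apply] at this

end Maximizers

/-- The Lagrangian per unit time of the uplink of a user with multipliers `l` and `m` who transmits
at power `Q` to the UAV hovering right above. -/
noncomputable def uplinkProfit (l m Q : ℝ) : ℝ :=
  l / N.T * Real.logb 2 (1 + Q * (N.β₀ / N.H ^ 2) / N.σsq) - m * Q

lemma power_nonneg (l m : ℝ) : 0 ≤ N.power l m := le_max_right _ _

lemma uplinkProfit_le_power {l m Q : ℝ} (hl : 0 ≤ l) (hm : 0 < m) (hQ : 0 ≤ Q) :
    N.uplinkProfit l m Q ≤ N.uplinkProfit l m (N.power l m) := by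
  have hT := N.T_pos
  have hH := N.H_pos
  have hβ := N.β₀_pos
  have hσ := N.σsq_pos
  have _ : 0 < Real.log 2 := Real.log_pos one_lt_two
  set a := l / (N.T * Real.log 2) with ha
  set c := N.β₀ / N.H ^ 2 / N.σsq with hc
  have hpower : N.power l m = max (a / m - 1 / c) 0 := by
    rw [power, snr, ha, hc]
    congr 2 <;> field_simp
  have hprofit : ∀ x, N.uplinkProfit l m x = a * Real.log (1 + c * x) - m * x := fun x => by
    rw [uplinkProfit, Real.logb, ha, hc]
    field_simp
  rw [hprofit, hprofit, hpower]
  exact mul_log_sub_le_waterFilling (by positivity) (by positivity) hm hQ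

lemma tendsto_power {α : Type*} {f : Filter α} {u v : α → ℝ} {l m : ℝ} (hm : 0 < m)
    (hu : Tendsto u f (𝓝 l)) (hv : Tendsto v f (𝓝 m)) :
    Tendsto (fun x => N.power (u x) (v x)) f (𝓝 (N.power l m)) := by
  have hT := N.T_pos
  have _ : 0 < Real.log 2 := Real.log_pos one_lt_two
  exact ((hu.div ((hv.const_mul N.T).mul_const _) (by positivity)).sub_const _).max
    tendsto_const_nhds

/-- The rates at which a decision increases the throughputs `R_k` (left components) and the
energy balances `D_k` (right components) of the users. -/
noncomputable def payoff (d : Decision K) : Fin K ⊕ Fin K → ℝ :=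
  Sum.elim (fun k => 1 / N.T * N.rate k (d.ρ k.succ) d.q (d.Q k))
    (fun k => N.harvest k (d.ρ 0) d.q - d.ρ k.succ * d.Q k)

/-- The throughputs `R_k` and the energy balances `D_k` of a schedule. -/
noncomputable def total (s : Schedule K) : Fin K ⊕ Fin K → ℝ :=
  Sum.elim (N.throughput s) (fun k => N.harvestedEnergy s k - N.consumedEnergy s k)

/-- The vector of lower bounds in the epigraph form: `R` for every `R_k` and `0` for every `D_k`. -/
def target (K : ℕ) (R : ℝ) : Fin K ⊕ Fin K → ℝ := Sum.elim (fun _ => R) 0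

variable {N}

lemma epiFeasible_iff {s : Schedule K} {R : ℝ} :
    N.EpiFeasible s R ↔ N.Admissible s ∧ target K R ≤ N.total s := by
  simp only [EpiFeasible, Feasible, target, total, Pi.le_def, Sum.forall, Sum.elim_inl,
    Sum.elim_inr, Pi.zero_apply, sub_nonneg]
  tauto

lemma lagrangian_eq {lam mu : Fin K → ℝ} (hsum : ∑ k, lam k = 1) (s : Schedule K) (R : ℝ) :
    N.lagrangian s R lam mu = Sum.elim lam mu ⬝ᵥ N.total s := by
  rw [lagrangian, hsum, sub_self, zero_mul, zero_add, total, sumElim_dotProduct_sumElim]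
  rfl

section Prices

variable {d : Decision K} (lam mu : Fin K → ℝ)

lemma dotProduct_payoff_downlink (hd : d.ρ = Pi.single 0 1) :
    Sum.elim lam mu ⬝ᵥ N.payoff d = N.phi d.q mu := by
  rw [payoff, sumElim_dotProduct_sumElim]
  simp only [dotProduct, rate, harvest, phi, hd, Pi.single_eq_same,
    Pi.single_eq_of_ne (Fin.succ_ne_zero _), zero_mul, mul_zero, sub_zero, Finset.sum_const_zero,
    zero_add]
  exact Finset.sum_congr rfl fun k _ => by ring

lemma dotProduct_payoff_uplink {k : Fin K} (hd : d.ρ = Pi.single k.succ 1) :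
    Sum.elim lam mu ⬝ᵥ N.payoff d =
      lam k / N.T * Real.logb 2 (1 + d.Q k * N.gain k d.q / N.σsq) - mu k * d.Q k := by
  rw [payoff, sumElim_dotProduct_sumElim]
  simp only [dotProduct, rate, harvest, hd, Pi.single_apply, Fin.succ_inj,
    (Fin.succ_ne_zero k).symm, if_false, ite_mul, one_mul, zero_mul, mul_ite, mul_zero, zero_sub,
    mul_neg, Finset.sum_neg_distrib, Finset.sum_ite_eq', Finset.mem_univ, if_true]
  ring

end Prices

/-- At the prices `lam` and `mu`, downlink power transfer and uplink transmission both earn at most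
`V` per unit time. -/
structure IsPriceBound (N : Network K) (lam mu : Fin K → ℝ) (V : ℝ) : Prop where
  phi_le : ∀ q, N.phi q mu ≤ V
  uplinkProfit_le : ∀ k Q, 0 ≤ Q → N.uplinkProfit (lam k) (mu k) Q ≤ V

lemma IsPriceBound.dotProduct_payoff_le {lam mu : Fin K → ℝ} {V : ℝ}
    (hV : N.IsPriceBound lam mu V) (hlam : 0 ≤ lam) {d : Decision K} {i : Fin (K + 1)}
    (hρ : d.ρ = Pi.single i 1) (hQ : 0 ≤ d.Q) : Sum.elim lam mu ⬝ᵥ N.payoff d ≤ V := by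
  have hT := N.T_pos
  have hσ := N.σsq_pos
  cases i using Fin.cases with
  | zero => exact (dotProduct_payoff_downlink lam mu hρ).trans_le (hV.phi_le _)
  | succ k =>
    have hQk : 0 ≤ d.Q k := hQ k
    have hlk : 0 ≤ lam k := hlam k
    have hgain := N.gain_pos k d.q
    have hgain_le := N.gain_self k ▸ N.gain_le_gain_self k d.q
    refine (dotProduct_payoff_uplink lam mu hρ).trans_le (le_trans ?_ (hV.uplinkProfit_le k _ hQk))
    unfold uplinkProfit
    gcongr
    norm_num

section PeriodMeasure

variable (N)

instance : IsFiniteMeasure N.periodMeasure := by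
  unfold periodMeasure
  infer_instance

lemma integral_const_periodMeasure (c : ℝ) : ∫ _, c ∂N.periodMeasure = N.T * c := by
  simp [periodMeasure, N.T_pos.le]

lemma ae_mem_period : ∀ᵐ t ∂N.periodMeasure, t ∈ Set.Ioc 0 N.T :=
  ae_restrict_mem measurableSet_Ioc

end PeriodMeasure

lemma total_schedule (d : Decision K) : N.total d.schedule = N.T • N.payoff d := by
  ext (k | k)
  · simp only [total, throughput, Decision.schedule, integral_const_periodMeasure, Sum.elim_inl,
      Pi.smul_apply, payoff, smul_eq_mul]
    ring
  · simp only [total, harvestedEnergy, consumedEnergy, Decision.schedule,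
      integral_const_periodMeasure, Sum.elim_inr, Pi.smul_apply, payoff, smul_eq_mul]
    ring

lemma admissible_schedule {d : Decision K} {i : Fin (K + 1)} (hρ : d.ρ = Pi.single i 1)
    (hQ : 0 ≤ d.Q) : N.Admissible d.schedule where
  binary j t _ := by
    simp only [Decision.schedule, hρ, Pi.single_apply]
    split_ifs <;> simp
  sum_eq_one t _ := by simp [Decision.schedule, hρ]
  power_nonneg k _ _ := hQ k
  measurable_ρ _ := aemeasurable_const
  measurable_Q _ := aemeasurable_const
  measurable_q := aemeasurable_const
  integrable k := integrable_const (d.ρ k.succ * d.Q k)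

namespace Admissible

variable {s : Schedule K} (hs : N.Admissible s)

include hs

lemma exists_mode {t : ℝ} (ht : t ∈ Set.Ioc 0 N.T) : ∃ i, (s.decision t).ρ = Pi.single i 1 :=
  exists_eq_single_of_sum_eq_one (fun i => hs.binary i t ht) (hs.sum_eq_one t ht)

lemma mode_nonneg (i : Fin (K + 1)) {t : ℝ} (ht : t ∈ Set.Ioc 0 N.T) : 0 ≤ s.ρ i t := by
  rcases hs.binary i t ht with h | h <;> simp [h]

lemma mode_le_one (i : Fin (K + 1)) {t : ℝ} (ht : t ∈ Set.Ioc 0 N.T) : s.ρ i t ≤ 1 := by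
  rcases hs.binary i t ht with h | h <;> simp [h]

lemma aemeasurable_gain (k : Fin K) :
    AEMeasurable (fun t => N.gain k (s.q t)) N.periodMeasure :=
  (N.continuous_gain k).measurable.comp_aemeasurable hs.measurable_q

lemma integrable_harvest (k : Fin K) :
    Integrable (fun t => N.harvest k (s.ρ 0 t) (s.q t)) N.periodMeasure := by
  have hη := N.η_pos
  have hP := N.P_pos
  refine Integrable.of_bound (C := N.η * N.P * 1 * N.gain k (N.w k)) ?_ ?_
  · exact (((hs.measurable_ρ 0).const_mul _).mul (hs.aemeasurable_gain k)).aestronglyMeasurable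
  · filter_upwards [N.ae_mem_period] with t ht
    have hmode := hs.mode_nonneg 0 ht
    have hgain := N.gain_pos k (s.q t)
    rw [harvest, Real.norm_of_nonneg (by positivity)]
    gcongr
    exacts [hs.mode_le_one 0 ht, N.gain_le_gain_self k _]

lemma integrable_rate (k : Fin K) :
    Integrable (fun t => N.rate k (s.ρ k.succ t) (s.q t) (s.Q k t)) N.periodMeasure := by
  have _ : 0 < Real.log 2 := Real.log_pos one_lt_two
  have hσ := N.σsq_pos
  refine ((hs.integrable k).const_mul (N.gain k (N.w k) / N.σsq / Real.log 2)).mono' ?_ ?_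
  · exact ((hs.measurable_ρ _).mul ((Real.measurable_log.comp_aemeasurable
      ((((hs.measurable_Q k).mul (hs.aemeasurable_gain k)).div_const _).const_add 1)).div_const
        _)).aestronglyMeasurable
  · filter_upwards [N.ae_mem_period] with t ht
    have hQ := hs.power_nonneg k t ht
    have hmode := hs.mode_nonneg k.succ ht
    have hgain := N.gain_pos k (s.q t)
    set x := s.Q k t * N.gain k (s.q t) / N.σsq with hx
    have hx0 : 0 ≤ x := by positivity
    have hlog_le : Real.log (1 + x) ≤ s.Q k t * N.gain k (N.w k) / N.σsq := by
      refine (Real.log_le_sub_one_of_pos (by positivity)).trans ?_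
      rw [add_sub_cancel_left, hx]
      gcongr
      exact N.gain_le_gain_self k _
    have hlog_nonneg : 0 ≤ Real.log (1 + x) := Real.log_nonneg (le_add_of_nonneg_right hx0)
    rw [rate, ← hx, Real.logb, Real.norm_of_nonneg (by positivity)]
    calc s.ρ k.succ t * (Real.log (1 + x) / Real.log 2)
        ≤ s.ρ k.succ t * (s.Q k t * N.gain k (N.w k) / N.σsq / Real.log 2) := by gcongr
      _ = _ := by ring

lemma integrable_payoff (i : Fin K ⊕ Fin K) :
    Integrable (fun t => N.payoff (s.decision t) i) N.periodMeasure := by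
  rcases i with k | k
  · exact (hs.integrable_rate k).const_mul _
  · exact (hs.integrable_harvest k).sub (hs.integrable k)

lemma total_eq_integral (i : Fin K ⊕ Fin K) :
    N.total s i = ∫ t, N.payoff (s.decision t) i ∂N.periodMeasure := by
  rcases i with k | k
  · exact (integral_const_mul _ _).symm
  · exact (integral_sub (hs.integrable_harvest k) (hs.integrable k)).symm

lemma dotProduct_total_le {lam mu : Fin K → ℝ} (hlam : 0 ≤ lam) {V : ℝ}
    (hV : N.IsPriceBound lam mu V) : Sum.elim lam mu ⬝ᵥ N.total s ≤ N.T * V := by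
  have hint : ∀ i ∈ Finset.univ, Integrable
      (fun t => Sum.elim lam mu i * N.payoff (s.decision t) i) N.periodMeasure :=
    fun i _ => (hs.integrable_payoff i).const_mul _
  calc Sum.elim lam mu ⬝ᵥ N.total s
      = ∫ t, Sum.elim lam mu ⬝ᵥ N.payoff (s.decision t) ∂N.periodMeasure := by
        simp only [dotProduct, integral_finsetSum _ hint, integral_const_mul, hs.total_eq_integral]
    _ ≤ ∫ _, V ∂N.periodMeasure := by
        refine integral_mono_ae (integrable_finsetSum _ hint) (integrable_const _) ?_
        filter_upwards [N.ae_mem_period] with t ht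
        obtain ⟨i, hi⟩ := hs.exists_mode ht
        exact hV.dotProduct_payoff_le hlam hi fun k => hs.power_nonneg k t ht
    _ = N.T * V := N.integral_const_periodMeasure V

end Admissible

lemma dual_le_iff {lam mu : Fin K → ℝ} (hd : DualFeasible lam mu) {V : ℝ} :
    N.dual lam mu ≤ ((N.T * V : ℝ) : EReal) ↔ N.IsPriceBound lam mu V := by
  simp only [dual, iSup_le_iff, EReal.coe_le_coe_iff, lagrangian_eq hd.1]
  refine ⟨fun h => ?_, fun h s hs _ => hs.dotProduct_total_le hd.2.1 h⟩
  have hconst : ∀ {d : Decision K} {i}, d.ρ = Pi.single i 1 → 0 ≤ d.Q →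
      Sum.elim lam mu ⬝ᵥ N.payoff d ≤ V := fun {d _} hρ hQ => by
    have := h _ (admissible_schedule hρ hQ) 0
    rw [total_schedule, dotProduct_smul, smul_eq_mul] at this
    exact le_of_mul_le_mul_left this N.T_pos
  refine ⟨fun q => ?_, fun k Q hQ => ?_⟩
  · have := hconst (d := ⟨Pi.single 0 1, 0, q⟩) rfl le_rfl
    rwa [dotProduct_payoff_downlink lam mu rfl] at this
  · have := hconst (d := ⟨Pi.single k.succ 1, fun _ => Q, N.w k⟩) rfl fun _ => hQ
    rwa [dotProduct_payoff_uplink lam mu rfl, gain_self] at this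

lemma EpiFeasible.le_of_isPriceBound {s : Schedule K} {R : ℝ} (hs : N.EpiFeasible s R)
    {lam mu : Fin K → ℝ} (hd : DualFeasible lam mu) {V : ℝ} (hV : N.IsPriceBound lam mu V) :
    R ≤ N.T * V := by
  obtain ⟨hadm, htarget⟩ := epiFeasible_iff.1 hs
  have hprices : 0 ≤ Sum.elim lam mu := by simpa [Pi.le_def] using hd.2
  calc R = Sum.elim lam mu ⬝ᵥ target K R := by
        simp [target, dotProduct, ← Finset.sum_mul, hd.1]
    _ ≤ Sum.elim lam mu ⬝ᵥ N.total s := dotProduct_le_dotProduct_of_nonneg_left htarget hprices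
    _ ≤ N.T * V := hadm.dotProduct_total_le hd.2.1 hV

section Combination

variable {lam mu a b : Fin K → ℝ}

variable (N) in
lemma le_phi_self (hmu : 0 ≤ mu) (k : Fin K) :
    N.η * N.P * mu k * N.gain k (N.w k) ≤ N.phi (N.w k) mu :=
  Finset.single_le_sum (f := fun j => N.η * N.P * mu j * N.gain j (N.w k))
    (fun j _ => mul_nonneg (mul_nonneg N.η_mul_P_pos.le (hmu j)) (N.gain_pos j _).le)
    (Finset.mem_univ k)

variable (N) in
lemma phi_le_sum (hmu : 0 ≤ mu) (q : Plane) :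
    N.phi q mu ≤ ∑ k, N.η * N.P * mu k * N.gain k (N.w k) :=
  Finset.sum_le_sum fun k _ => mul_le_mul_of_nonneg_left (N.gain_le_gain_self k q)
    (mul_nonneg N.η_mul_P_pos.le (hmu k))

variable (N) in
lemma phi_combination (q : Plane) (x y : ℝ) :
    N.phi q (x • mu + y • b) = x * N.phi q mu + y * N.phi q b := by
  simp only [phi, Pi.add_apply, Pi.smul_apply, smul_eq_mul, Finset.mul_sum,
    ← Finset.sum_add_distrib]
  exact Finset.sum_congr rfl fun k _ => by ring

variable (N) in
lemma uplinkProfit_combination (x y l m l' m' Q : ℝ) :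
    N.uplinkProfit (x * l + y * l') (x * m + y * m') Q =
      x * N.uplinkProfit l m Q + y * N.uplinkProfit l' m' Q := by
  simp only [uplinkProfit]
  ring

lemma DualFeasible.combination (hd : DualFeasible lam mu) (ha : 0 ≤ a) (hb : 0 ≤ b) {ε : ℝ}
    (hε : 0 ≤ ε) (hle : 0 ≤ 1 - ε * ∑ k, a k) :
    DualFeasible ((1 - ε * ∑ k, a k) • lam + ε • a) ((1 - ε * ∑ k, a k) • mu + ε • b) := by
  obtain ⟨hsum, hlam, hmu⟩ := hd
  refine ⟨?_, fun k => add_nonneg (mul_nonneg hle (hlam k)) (mul_nonneg hε (ha k)),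
    fun k => add_nonneg (mul_nonneg hle (hmu k)) (mul_nonneg hε (hb k))⟩
  simp only [Pi.add_apply, Pi.smul_apply, smul_eq_mul, Finset.sum_add_distrib, ← Finset.mul_sum,
    hsum]
  ring

end Combination

section PriceBound

variable {lam mu : Fin K → ℝ} {V : ℝ}

lemma isPriceBound_of_le (hd : DualFeasible lam mu) (hmu : ∀ k, 0 < mu k) {q : Plane}
    (hq : q ∈ N.maximizers mu) (hphi : N.phi q mu ≤ V)
    (hup : ∀ k, N.uplinkProfit (lam k) (mu k) (N.power (lam k) (mu k)) ≤ V) :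
    N.IsPriceBound lam mu V :=
  ⟨fun q' => (hq q').trans hphi,
    fun k _ hQ => (N.uplinkProfit_le_power (hd.2.1 k) (hmu k) hQ).trans (hup k)⟩

variable [NeZero K]

lemma exists_isPriceBound (hd : DualFeasible lam mu) (hmu : ∀ k, 0 < mu k) :
    ∃ V, N.IsPriceBound lam mu V := by
  obtain ⟨q, hq⟩ := N.maximizers_nonempty (N.phi_pos_of_forall_pos hmu 0)
  obtain ⟨M, hM⟩ := Finite.exists_le fun k => N.uplinkProfit (lam k) (mu k) (N.power (lam k) (mu k))
  exact ⟨max (N.phi q mu) M, isPriceBound_of_le hd hmu hq (le_max_left _ _)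
    fun k => (hM k).trans (le_max_right _ _)⟩

lemma exists_lt_isPriceBound (hd : DualFeasible lam mu) (hmu : ∀ k, 0 < mu k)
    (hphi : ∀ q, N.phi q mu < V)
    (hup : ∀ k, N.uplinkProfit (lam k) (mu k) (N.power (lam k) (mu k)) < V) :
    ∃ V' < V, N.IsPriceBound lam mu V' := by
  obtain ⟨q, hq⟩ := N.maximizers_nonempty (N.phi_pos_of_forall_pos hmu 0)
  have hnear : ∀ {x}, x < V → ∀ᶠ V' in 𝓝[<] V, x ≤ V' := fun hx =>
    nhdsWithin_le_nhds (eventually_ge_nhds hx)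
  obtain ⟨V', hphi', hup', hV'⟩ := ((hnear (hphi q)).and
    ((eventually_all.2 fun k => hnear (hup k)).and self_mem_nhdsWithin)).exists
  exact ⟨V', hV', isPriceBound_of_le hd hmu hq hphi' hup'⟩

end PriceBound

variable (N) in
lemma exists_dualFeasible_isPriceBound [NeZero K] :
    ∃ lam mu V, DualFeasible lam mu ∧ N.IsPriceBound lam mu V := by
  have hd : DualFeasible (Pi.single 0 1 : Fin K → ℝ) 1 :=
    ⟨by simp, fun k => (Pi.single_nonneg.2 zero_le_one : (0 : Fin K → ℝ) ≤ _) k,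
      fun _ => zero_le_one⟩
  obtain ⟨V, hV⟩ := N.exists_isPriceBound hd fun _ => one_pos
  exact ⟨_, _, V, hd, hV⟩

variable (N) in
lemma lowerSemicontinuous_dual :
    LowerSemicontinuous fun x : (Fin K → ℝ) × (Fin K → ℝ) => N.dual x.1 x.2 := by
  refine lowerSemicontinuous_iSup fun s => lowerSemicontinuous_iSup fun _ =>
    lowerSemicontinuous_iSup fun R => (continuous_coe_real_ereal.comp ?_).lowerSemicontinuous
  unfold lagrangian
  fun_prop

lemma IsPriceBound.mu_le {lam mu : Fin K → ℝ} {V : ℝ} (hV : N.IsPriceBound lam mu V)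
    (hmu : 0 ≤ mu) (k : Fin K) : mu k ≤ V / (N.η * N.P * N.gain k (N.w k)) := by
  rw [le_div_iff₀ (mul_pos (N.η_mul_P_pos) (N.gain_pos k _))]
  linarith [N.le_phi_self hmu k, hV.phi_le (N.w k)]

variable (N) in
lemma exists_isDualOptimal [NeZero K] : ∃ lam mu : Fin K → ℝ, N.IsDualOptimal lam mu := by
  obtain ⟨lam₀, mu₀, V, hd₀, hV₀⟩ := N.exists_dualFeasible_isPriceBound
  let C : Set ((Fin K → ℝ) × (Fin K → ℝ)) :=
    stdSimplex ℝ (Fin K) ×ˢ Set.Icc 0 fun k => V / (N.η * N.P * N.gain k (N.w k))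
  have hC : ∀ {lam mu}, DualFeasible lam mu → N.dual lam mu ≤ ((N.T * V : ℝ) : EReal) →
      (lam, mu) ∈ C := fun hd hle =>
    ⟨⟨hd.2.1, hd.1⟩, hd.2.2, ((dual_le_iff hd).1 hle).mu_le hd.2.2⟩
  have hdual₀ := (dual_le_iff hd₀).2 hV₀
  obtain ⟨⟨lam, mu⟩, hmem, hmin⟩ := LowerSemicontinuousOn.exists_isMinOn ⟨_, hC hd₀ hdual₀⟩
    ((isCompact_stdSimplex ℝ (Fin K)).prod isCompact_Icc)
    (N.lowerSemicontinuous_dual.lowerSemicontinuousOn _)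
  have hmin' : ∀ x ∈ C, N.dual lam mu ≤ N.dual x.1 x.2 := isMinOn_iff.1 hmin
  refine ⟨lam, mu, ⟨hmem.1.2, hmem.1.1, fun k => hmem.2.1 k⟩, fun lam' mu' hd' => ?_⟩
  rcases le_or_gt (N.dual lam' mu') ((N.T * V : ℝ) : EReal) with h | h
  · exact hmin' (lam', mu') (hC hd' h)
  · exact (hmin' (lam₀, mu₀) (hC hd₀ hdual₀)).trans (hdual₀.trans h.le)

/-- `V` is the least price bound over all dual feasible multipliers, and `(lam, mu)` attains it, so
that `N.T * V` is the optimal value of the dual problem. -/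
structure IsDualValue (N : Network K) (lam mu : Fin K → ℝ) (V : ℝ) : Prop where
  feasible : DualFeasible lam mu
  isPriceBound : N.IsPriceBound lam mu V
  le : ∀ {lam' mu' : Fin K → ℝ} {V' : ℝ}, DualFeasible lam' mu' → N.IsPriceBound lam' mu' V' →
    V ≤ V'

lemma IsDualOptimal.exists_isDualValue [NeZero K] {lam mu : Fin K → ℝ}
    (h : N.IsDualOptimal lam mu) : ∃ V, N.IsDualValue lam mu V := by
  obtain ⟨hd, hmin⟩ := h
  obtain ⟨lam₀, mu₀, V₀, hd₀, hV₀⟩ := N.exists_dualFeasible_isPriceBound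
  have htop : N.dual lam mu ≠ ⊤ :=
    (((hmin _ _ hd₀).trans ((dual_le_iff hd₀).2 hV₀)).trans_lt (EReal.coe_lt_top _)).ne
  have hbot : N.dual lam mu ≠ ⊥ := fun hbot => by
    have hV : N.IsPriceBound lam mu (N.phi 0 mu - 1) := (dual_le_iff hd).1 (hbot ▸ bot_le)
    linarith [hV.phi_le 0]
  set V := (N.dual lam mu).toReal / N.T with hV
  have hdual : N.dual lam mu = ((N.T * V : ℝ) : EReal) := by
    rw [hV, mul_div_cancel₀ _ N.T_pos.ne', EReal.coe_toReal htop hbot]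
  refine ⟨V, hd, (dual_le_iff hd).1 hdual.le, fun {lam' mu' V'} hd' hV' => ?_⟩
  have hle := hdual ▸ (hmin _ _ hd').trans ((dual_le_iff hd').2 hV')
  exact le_of_mul_le_mul_left (EReal.coe_le_coe_iff.1 hle) N.T_pos

section FirstOrder

variable {lam mu a b : Fin K → ℝ} {V A : ℝ}

lemma tendsto_combination (A x y : ℝ) :
    Tendsto (fun ε : ℝ => (1 - ε * A) * x + ε * y) (𝓝[>] 0) (𝓝 x) := by
  have hcont : Continuous fun ε : ℝ => (1 - ε * A) * x + ε * y := by fun_prop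
  simpa using (hcont.tendsto 0).mono_left nhdsWithin_le_nhds

variable (N) in
lemma tendsto_uplinkProfit_atTop {l : ℝ} (hl : 0 < l) :
    Tendsto (N.uplinkProfit l 0) atTop atTop := by
  have hgain : 0 < N.β₀ / N.H ^ 2 := div_pos N.β₀_pos (pow_pos N.H_pos 2)
  have hsnr : Tendsto (fun Q : ℝ => 1 + Q * (N.β₀ / N.H ^ 2) / N.σsq) atTop atTop :=
    tendsto_atTop_add_const_left _ _
      ((tendsto_id.atTop_mul_const hgain).atTop_div_const N.σsq_pos)
  have hprofit : N.uplinkProfit l 0 =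
      fun Q => l / N.T * Real.logb 2 (1 + Q * (N.β₀ / N.H ^ 2) / N.σsq) := by
    ext Q
    rw [uplinkProfit, zero_mul, sub_zero]
  rw [hprofit]
  exact ((Real.tendsto_logb_atTop one_lt_two).comp hsnr).const_mul_atTop (div_pos hl N.T_pos)

lemma IsPriceBound.mu_pos_of_lam_pos (hV : N.IsPriceBound lam mu V) (hmu : 0 ≤ mu) {k : Fin K}
    (hlam : 0 < lam k) : 0 < mu k := by
  refine (hmu k).lt_of_ne' fun hzero => ?_
  obtain ⟨Q, hgt, hQ⟩ := (((N.tendsto_uplinkProfit_atTop hlam).eventually_gt_atTop V).and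
    (eventually_ge_atTop 0)).exists
  exact (hzero ▸ hV.uplinkProfit_le k Q hQ).not_gt hgt

lemma IsDualValue.pos (h : N.IsDualValue lam mu V) : 0 < V := by
  obtain ⟨hsum, -, hmu⟩ := h.feasible
  obtain ⟨j, -, hj⟩ : ∃ j ∈ Finset.univ, (0 : ℝ) < lam j :=
    Finset.exists_lt_of_sum_lt (by simp [hsum])
  exact (N.phi_pos hmu (h.isPriceBound.mu_pos_of_lam_pos hmu hj) 0).trans_le
    (h.isPriceBound.phi_le 0)

lemma IsPriceBound.combination_single (hV : N.IsPriceBound lam mu V) {k : Fin K}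
    (hlam : lam k = 0) (hmu : mu k = 0) {δ : ℝ} (hδ : 0 < δ) {ε : ℝ} (hε0 : 0 ≤ ε) (hε1 : ε ≤ 1) :
    N.IsPriceBound ((1 - ε) • lam + ε • Pi.single k 1) ((1 - ε) • mu + ε • Pi.single k δ)
      (max ((1 - ε) * V + ε * (N.η * N.P * δ * N.gain k (N.w k)))
        (ε * N.uplinkProfit 1 δ (N.power 1 δ))) := by
  have hηP := N.η_mul_P_pos
  have hgain := N.gain_pos k (N.w k)
  have hε1' : 0 ≤ 1 - ε := sub_nonneg.2 hε1
  refine ⟨fun q => le_max_of_le_left ?_, fun j Q hQ => ?_⟩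
  · have hphi : N.phi q (Pi.single k δ) ≤ N.η * N.P * δ * N.gain k (N.w k) := by
      simp only [phi, Pi.single_apply, mul_ite, ite_mul, mul_zero, zero_mul, Finset.sum_ite_eq',
        Finset.mem_univ, if_true]
      gcongr
      exact N.gain_le_gain_self k q
    rw [phi_combination]
    gcongr
    exact hV.phi_le q
  · have hidle : N.uplinkProfit 0 0 Q = 0 := by simp [uplinkProfit]
    simp only [Pi.add_apply, Pi.smul_apply, smul_eq_mul, uplinkProfit_combination]
    rcases eq_or_ne j k with rfl | hj
    · rw [hlam, hmu, Pi.single_eq_same, Pi.single_eq_same, hidle, mul_zero, zero_add]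
      exact le_max_of_le_right
        (mul_le_mul_of_nonneg_left (N.uplinkProfit_le_power zero_le_one hδ hQ) hε0)
    · rw [Pi.single_eq_of_ne hj, Pi.single_eq_of_ne hj, hidle, mul_zero]
      exact le_max_of_le_left (add_le_add
        (mul_le_mul_of_nonneg_left (hV.uplinkProfit_le j Q hQ) hε1') (by positivity))

lemma IsDualValue.mu_pos (h : N.IsDualValue lam mu V) (k : Fin K) : 0 < mu k := by
  obtain ⟨-, hlam, hmu⟩ := h.feasible
  refine (hmu k).lt_of_ne' fun hmuk => ?_
  have hlamk : lam k = 0 := le_antisymm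
    (not_lt.1 fun hpos => (h.isPriceBound.mu_pos_of_lam_pos hmu hpos).ne' hmuk) (hlam k)
  -- Moving the multipliers of user `k` away from zero, along `(1, δ)` with `δ` so small that `φ`
  -- stays below `V / 2` in the limit direction, would lower the price bound.
  have hV := h.pos
  set c := N.η * N.P * N.gain k (N.w k) with hc
  have hc0 : 0 < c := mul_pos N.η_mul_P_pos (N.gain_pos k _)
  set δ := V / (2 * c) with hδ
  have hδ0 : 0 < δ := by positivity
  have hcharge : N.η * N.P * δ * N.gain k (N.w k) = V / 2 := by
    rw [mul_right_comm, ← hc, hδ]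
    field_simp
  have hsmall : Tendsto (fun ε => ε * N.uplinkProfit 1 δ (N.power 1 δ)) (𝓝[>] 0) (𝓝 0) := by
    simpa using tendsto_combination 0 0 (N.uplinkProfit 1 δ (N.power 1 δ))
  obtain ⟨ε, hup, hε0, hε1⟩ := ((hsmall.eventually_lt_const hV).and
    (Ioo_mem_nhdsGT one_pos)).exists
  have hfeas := h.feasible.combination (Pi.single_nonneg.2 zero_le_one : 0 ≤ Pi.single k 1)
    (Pi.single_nonneg.2 hδ0.le : 0 ≤ Pi.single k δ) hε0.le (by simpa using hε1.le)
  rw [Finset.sum_pi_single', if_pos (Finset.mem_univ k), mul_one] at hfeas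
  refine (h.le hfeas (h.isPriceBound.combination_single hlamk hmuk hδ0 hε0.le hε1.le)).not_gt
    (max_lt ?_ hup)
  rw [hcharge]
  nlinarith

lemma eventually_combination_weight_pos (A : ℝ) : ∀ᶠ ε in 𝓝[>] 0, 0 < ε ∧ 0 < 1 - ε * A := by
  filter_upwards [self_mem_nhdsWithin,
    (tendsto_combination A 1 0).eventually_const_lt one_pos] with ε hε hweight
  exact ⟨hε, by simpa using hweight⟩

lemma eventually_combination_phi_lt (hV : ∀ q, N.phi q mu ≤ V) (hpos : ∀ q, 0 < N.phi q mu)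
    (hb : 0 ≤ b) (h : ∀ q ∈ N.maximizers mu, N.phi q b < A * V) :
    ∀ᶠ ε in 𝓝[>] 0, ∀ q, N.phi q ((1 - ε * A) • mu + ε • b) < V := by
  -- Off the open set where `φ(·, b) < A V` the maximum of `φ(·, mu)` is less than `V`.
  obtain ⟨V', hV', hle⟩ : ∃ V' < V, ∀ q, A * V ≤ N.phi q b → N.phi q mu ≤ V' := by
    rcases Set.eq_empty_or_nonempty {q | A * V ≤ N.phi q b} with hempty | ⟨q₀, hq₀⟩
    · exact ⟨0, (hpos 0).trans_le (hV 0),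
        fun q hq => absurd hq (Set.eq_empty_iff_forall_notMem.1 hempty q)⟩
    · obtain ⟨q₁, hq₁, hmax⟩ := N.exists_isMaxOn_phi
        (isClosed_le continuous_const (N.continuous_phi b)) hq₀ (hpos q₀)
      exact ⟨N.phi q₁ mu, not_le.1 fun hge => (h q₁ fun q => (hV q).trans hge).not_ge hq₁,
        fun q hq => hmax hq⟩
  filter_upwards [eventually_combination_weight_pos A,
    (tendsto_combination A V' (∑ k, N.η * N.P * b k * N.gain k (N.w k))).eventually_lt_const hV']
    with ε ⟨hε, hweight⟩ hbound q
  rw [phi_combination]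
  rcases lt_or_ge (N.phi q b) (A * V) with hq | hq
  · nlinarith [hV q]
  · refine lt_of_le_of_lt ?_ hbound
    gcongr
    exacts [hle q hq, N.phi_le_sum hb q]

variable (N) in
lemma continuousAt_uplinkProfit (l m : ℝ) {Q : ℝ} (hQ : 0 ≤ Q) :
    ContinuousAt (N.uplinkProfit l m) Q := by
  have hβ := N.β₀_pos
  have hσ := N.σsq_pos
  have hH := N.H_pos
  unfold uplinkProfit Real.logb
  exact ((((by fun_prop : ContinuousAt (fun Q => 1 + Q * (N.β₀ / N.H ^ 2) / N.σsq) Q).log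
    (by positivity)).div_const _).const_mul _).sub (by fun_prop)

lemma eventually_combination_uplinkProfit_lt {l m x y : ℝ} (hm : 0 < m)
    (hV : ∀ Q, 0 ≤ Q → N.uplinkProfit l m Q ≤ V)
    (h : N.uplinkProfit x y (N.power l m) < A * V) :
    ∀ᶠ ε in 𝓝[>] 0, N.uplinkProfit ((1 - ε * A) * l + ε * x) ((1 - ε * A) * m + ε * y)
      (N.power ((1 - ε * A) * l + ε * x) ((1 - ε * A) * m + ε * y)) < V := by
  have hpower := N.tendsto_power hm (tendsto_combination A l x) (tendsto_combination A m y)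
  filter_upwards [eventually_combination_weight_pos A,
    ((N.continuousAt_uplinkProfit x y (N.power_nonneg l m)).tendsto.comp
      hpower).eventually_lt_const h] with ε ⟨hε, hweight⟩ hlt
  rw [uplinkProfit_combination]
  calc _ < (1 - ε * A) * V + ε * (A * V) := add_lt_add_of_le_of_lt
        (mul_le_mul_of_nonneg_left (hV _ (N.power_nonneg _ _)) hweight.le)
        (mul_lt_mul_of_pos_left hlt hε)
    _ = V := by ring

lemma IsDualValue.exists_le_phi [NeZero K] (h : N.IsDualValue lam mu V) (ha : 0 ≤ a) (hb : 0 ≤ b)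
    (hup : ∀ k, N.uplinkProfit (a k) (b k) (N.power (lam k) (mu k)) < (∑ k, a k) * V) :
    ∃ q ∈ N.maximizers mu, (∑ k, a k) * V ≤ N.phi q b := by
  by_contra! hphi
  have hmu := h.mu_pos
  obtain ⟨ε, ⟨hε, hweight⟩, hphi', hup'⟩ :=
    ((eventually_combination_weight_pos (∑ k, a k)).and
      ((eventually_combination_phi_lt h.isPriceBound.phi_le
        (N.phi_pos_of_forall_pos hmu) hb hphi).and
      (eventually_all.2 fun k => eventually_combination_uplinkProfit_lt (hmu k)
        (h.isPriceBound.uplinkProfit_le k) (hup k)))).exists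
  have hd := h.feasible.combination ha hb hε.le hweight.le
  obtain ⟨V', hV', hbound⟩ := N.exists_lt_isPriceBound hd
    (fun k => add_pos_of_pos_of_nonneg (mul_pos hweight (hmu k)) (mul_nonneg hε.le (hb k)))
    hphi' hup'
  exact (h.le hd hbound).not_gt hV'

end FirstOrder

section Hovering

variable {lam mu : Fin K → ℝ} {Ω : ℕ} {qbar : Fin Ω → Plane} {ς : Fin K → ℝ} {τ : Fin Ω → ℝ}

/-- The durations of the sub-periods of a hovering schedule: they are nonnegative and fill the
period. -/
structure IsAllocation (N : Network K) (ς : Fin K → ℝ) (τ : Fin Ω → ℝ) : Prop where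
  ς_nonneg : ∀ k, 0 ≤ ς k
  τ_nonneg : ∀ ω, 0 ≤ τ ω
  total_time : ∑ k, ς k + ∑ ω, τ ω = N.T

variable (N) in
/-- The decisions of a hovering schedule: downlink power transfer at `qbar ω` (left indices) and
uplink of user `k` from right above (right indices). -/
noncomputable def hover (lam mu : Fin K → ℝ) (qbar : Fin Ω → Plane) : Fin Ω ⊕ Fin K → Decision K :=
  Sum.elim (fun ω => ⟨Pi.single 0 1, 0, qbar ω⟩)
    fun k => ⟨Pi.single k.succ 1, Pi.single k (N.power (lam k) (mu k)), N.w k⟩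

/-- The sub-periods of a hovering schedule, indexed like `hover`. -/
def subPeriod (ς : Fin K → ℝ) (τ : Fin Ω → ℝ) : Fin Ω ⊕ Fin K → Set ℝ :=
  Sum.elim (downlinkPeriod τ) (uplinkPeriod ς τ)

lemma sum_payoff_hover_inl (k : Fin K) :
    (∑ i, Sum.elim τ ς i • N.payoff (N.hover lam mu qbar i)) (Sum.inl k) =
      ς k / N.T * Real.logb 2 (1 + N.power (lam k) (mu k) * N.gain k (N.w k) / N.σsq) := by
  have hdownlink : ∀ ω, N.payoff (N.hover lam mu qbar (Sum.inl ω)) (Sum.inl k) = 0 := fun ω => by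
    simp [payoff, hover, rate]
  have huplink : ∀ j ≠ k, N.payoff (N.hover lam mu qbar (Sum.inr j)) (Sum.inl k) = 0 :=
    fun j hj => by simp [payoff, hover, rate, hj.symm]
  have huplink_self : N.payoff (N.hover lam mu qbar (Sum.inr k)) (Sum.inl k) =
      1 / N.T * Real.logb 2 (1 + N.power (lam k) (mu k) * N.gain k (N.w k) / N.σsq) := by
    simp [payoff, hover, rate]
  simp only [Finset.sum_apply, Fintype.sum_sum_type, Sum.elim_inl, Sum.elim_inr, Pi.smul_apply,
    smul_eq_mul, hdownlink, mul_zero, Finset.sum_const_zero, zero_add]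
  rw [Finset.sum_eq_single_of_mem k (Finset.mem_univ k) fun j _ hj => by
    rw [huplink j hj, mul_zero], huplink_self]
  ring

lemma sum_payoff_hover_inr (k : Fin K) :
    (∑ i, Sum.elim τ ς i • N.payoff (N.hover lam mu qbar i)) (Sum.inr k) =
      ∑ ω, τ ω * (N.η * N.P * N.gain k (qbar ω)) - ς k * N.power (lam k) (mu k) := by
  have hdownlink : ∀ ω, N.payoff (N.hover lam mu qbar (Sum.inl ω)) (Sum.inr k) =
      N.η * N.P * N.gain k (qbar ω) := fun ω => by
    simp [payoff, hover, harvest]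
  have huplink : ∀ j ≠ k, N.payoff (N.hover lam mu qbar (Sum.inr j)) (Sum.inr k) = 0 :=
    fun j hj => by simp [payoff, hover, harvest, hj.symm]
  have huplink_self : N.payoff (N.hover lam mu qbar (Sum.inr k)) (Sum.inr k) =
      -N.power (lam k) (mu k) := by
    simp [payoff, hover, harvest]
  simp only [Finset.sum_apply, Fintype.sum_sum_type, Sum.elim_inl, Sum.elim_inr, Pi.smul_apply,
    smul_eq_mul, hdownlink]
  rw [Finset.sum_eq_single_of_mem k (Finset.mem_univ k) fun j _ hj => by
    rw [huplink j hj, mul_zero], huplink_self, mul_neg, sub_eq_add_neg]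

lemma lpFeasible_iff {R : ℝ} : N.LPFeasible lam mu qbar ς τ R ↔
    N.IsAllocation ς τ ∧
      target K R ≤ ∑ i, Sum.elim τ ς i • N.payoff (N.hover lam mu qbar i) := by
  simp only [target, Pi.le_def, Sum.forall, Sum.elim_inl, Sum.elim_inr, Pi.zero_apply,
    sum_payoff_hover_inl, sum_payoff_hover_inr, sub_nonneg]
  exact ⟨fun ⟨hς, hτ, hR, hE, hT⟩ => ⟨⟨hς, hτ, hT⟩, hR, hE⟩,
    fun ⟨⟨hς, hτ, hT⟩, hR, hE⟩ => ⟨hς, hτ, hR, hE, hT⟩⟩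

lemma IsDualValue.exists_lpFeasible [NeZero K] {V : ℝ} (h : N.IsDualValue lam mu V)
    (hq : N.maximizers mu ⊆ Set.range qbar) : ∃ ς τ, N.LPFeasible lam mu qbar ς τ (N.T * V) := by
  have hT := N.T_pos
  rcases exists_mem_stdSimplex_or_exists_dotProduct_lt
    (fun i => N.payoff (N.hover lam mu qbar i)) (target K V) with ⟨θ, hθ, hle⟩ | ⟨x, hx, hlt⟩
  · refine ⟨fun k => N.T * θ (Sum.inr k), fun ω => N.T * θ (Sum.inl ω), lpFeasible_iff.2
      ⟨⟨fun k => mul_nonneg hT.le (hθ.1 _), fun ω => mul_nonneg hT.le (hθ.1 _), ?_⟩, ?_⟩⟩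
    · rw [← Finset.mul_sum, ← Finset.mul_sum, ← mul_add, add_comm, ← Fintype.sum_sum_type, hθ.2,
        mul_one]
    · have hscale : target K (N.T * V) = N.T • target K V := by
        ext (_ | _) <;> simp [target]
      have hdur : Sum.elim (fun ω => N.T * θ (Sum.inl ω)) (fun k => N.T * θ (Sum.inr k)) =
          N.T • θ := by
        ext (ω | k) <;> rfl
      simp only [hscale, hdur, Pi.smul_apply, smul_assoc, ← Finset.smul_sum]
      exact smul_le_smul_of_nonneg_left hle hT.le
  · -- A separating vector is a descent direction of the dual, which is impossible.
    obtain ⟨a, b, rfl⟩ : ∃ a b, x = Sum.elim a b := ⟨_, _, (Sum.elim_comp_inl_inr x).symm⟩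
    have htarget : Sum.elim a b ⬝ᵥ target K V = (∑ k, a k) * V := by
      simp [target, dotProduct, Finset.sum_mul]
    rw [htarget] at hlt
    obtain ⟨q, hqmax, hge⟩ := h.exists_le_phi (fun k => hx (Sum.inl k)) (fun k => hx (Sum.inr k))
      fun k => by
        have huplink := hlt (Sum.inr k)
        rw [dotProduct_payoff_uplink a b rfl] at huplink
        simpa [uplinkProfit, hover, gain_self] using huplink
    obtain ⟨ω, rfl⟩ := hq hqmax
    have hdownlink := hlt (Sum.inl ω)
    rw [dotProduct_payoff_downlink a b rfl] at hdownlink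
    exact absurd hge hdownlink.not_ge

lemma isHovering_iff {s : Schedule K} : N.IsHovering lam mu qbar ς τ s ↔
    ∀ i, ∀ t ∈ subPeriod ς τ i, s.decision t = N.hover lam mu qbar i := by
  have hdownlink : ∀ ω t, s.decision t = N.hover lam mu qbar (Sum.inl ω) ↔
      s.q t = qbar ω ∧ s.ρ 0 t = 1 ∧ ∀ k : Fin K, s.ρ k.succ t = 0 ∧ s.Q k t = 0 := fun ω t => by
    simp only [Schedule.decision, hover, Sum.elim_inl, Decision.mk.injEq, funext_iff,
      Fin.forall_fin_succ, Pi.single_eq_same, Pi.single_eq_of_ne (Fin.succ_ne_zero _),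
      Pi.zero_apply, forall_and]
    tauto
  have huplink : ∀ k t, s.decision t = N.hover lam mu qbar (Sum.inr k) ↔
      s.q t = N.w k ∧ s.ρ k.succ t = 1 ∧ s.Q k t = N.power (lam k) (mu k) ∧ s.ρ 0 t = 0 ∧
        ∀ j : Fin K, j ≠ k → s.ρ j.succ t = 0 ∧ s.Q j t = 0 := fun k t => by
    simp only [Schedule.decision, hover, Sum.elim_inr, Decision.mk.injEq, funext_iff,
      Fin.forall_fin_succ, Pi.single_apply, (Fin.succ_ne_zero k).symm,
      if_false, Fin.succ_inj]
    refine ⟨fun ⟨⟨h₀, hρ⟩, hQ, hq⟩ => ⟨hq, (hρ k).trans (if_pos rfl), (hQ k).trans (if_pos rfl), h₀,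
      fun j hj => ⟨(hρ j).trans (if_neg hj), (hQ j).trans (if_neg hj)⟩⟩,
      fun ⟨hq, hρ, hQ, h₀, hj⟩ => ⟨⟨h₀, fun j => ?_⟩, fun j => ?_, hq⟩⟩ <;>
    split_ifs with h
    exacts [h ▸ hρ, (hj j h).1, h ▸ hQ, (hj j h).2]
  simp only [Sum.forall, hdownlink, huplink, subPeriod, Sum.elim_inl, Sum.elim_inr]
  exact ⟨fun h => ⟨h.downlink, h.uplink⟩, fun h => ⟨h.1, h.2⟩⟩

lemma measurableSet_subPeriod (i : Fin Ω ⊕ Fin K) : MeasurableSet (subPeriod ς τ i) := by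
  cases i <;> exact measurableSet_Ioc

lemma volume_subPeriod_ne_top (i : Fin Ω ⊕ Fin K) : volume (subPeriod ς τ i) ≠ ⊤ := by
  cases i <;> exact measure_Ioc_lt_top.ne

lemma downlinkPeriod_eq (τ : Fin Ω → ℝ) : downlinkPeriod τ = fun ω =>
    Set.Ioc (0 + ∑ j ∈ Finset.Iio ω, τ j) (0 + ∑ j ∈ Finset.Iic ω, τ j) := by
  simp only [zero_add]
  rfl

lemma iUnion_downlinkPeriod (hτ : ∀ ω, 0 ≤ τ ω) :
    ⋃ ω, downlinkPeriod τ ω = Set.Ioc 0 (∑ ω, τ ω) := by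
  rw [downlinkPeriod_eq, iUnion_stacked_Ioc hτ, zero_add]

lemma iUnion_uplinkPeriod (hς : ∀ k, 0 ≤ ς k) :
    ⋃ k, uplinkPeriod ς τ k = Set.Ioc (∑ ω, τ ω) (∑ ω, τ ω + ∑ k, ς k) :=
  iUnion_stacked_Ioc hς _

lemma pairwise_disjoint_subPeriod (hς : ∀ k, 0 ≤ ς k) (hτ : ∀ ω, 0 ≤ τ ω) :
    Pairwise (Function.onFun Disjoint (subPeriod ς τ)) := by
  have hcross : ∀ ω k, Disjoint (downlinkPeriod τ ω) (uplinkPeriod ς τ k) := fun ω k =>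
    (Set.Ioc_disjoint_Ioc_of_le le_rfl).mono
      ((Set.subset_iUnion _ ω).trans (iUnion_downlinkPeriod hτ).subset)
      ((Set.subset_iUnion _ k).trans (iUnion_uplinkPeriod hς).subset)
  have hdownlink : Pairwise (Function.onFun Disjoint (downlinkPeriod τ)) :=
    downlinkPeriod_eq τ ▸ pairwise_disjoint_stacked_Ioc hτ 0
  have huplink : Pairwise (Function.onFun Disjoint (uplinkPeriod ς τ)) :=
    pairwise_disjoint_stacked_Ioc hς _
  rintro (ω | k) (ω' | k') h
  · exact hdownlink (ne_of_apply_ne Sum.inl h)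
  · exact hcross ω k'
  · exact (hcross ω' k).symm
  · exact huplink (ne_of_apply_ne Sum.inr h)

lemma volume_real_subPeriod (hς : ∀ k, 0 ≤ ς k) (hτ : ∀ ω, 0 ≤ τ ω) (i : Fin Ω ⊕ Fin K) :
    volume.real (subPeriod ς τ i) = Sum.elim τ ς i := by
  rcases i with ω | k
  · rw [subPeriod, Sum.elim_inl, downlinkPeriod_eq]
    exact volume_real_stacked_Ioc hτ 0 ω
  · exact volume_real_stacked_Ioc hς _ k

lemma IsAllocation.iUnion_subPeriod (h : N.IsAllocation ς τ) :
    ⋃ i, subPeriod ς τ i = Set.Ioc 0 N.T := by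
  rw [Set.iUnion_sum]
  simp only [subPeriod, Sum.elim_inl, Sum.elim_inr, iUnion_downlinkPeriod h.τ_nonneg,
    iUnion_uplinkPeriod h.ς_nonneg]
  rw [Set.Ioc_union_Ioc_eq_Ioc (Finset.sum_nonneg fun ω _ => h.τ_nonneg ω)
    (le_add_of_nonneg_right (Finset.sum_nonneg fun k _ => h.ς_nonneg k)), add_comm, h.total_time]

lemma IsAllocation.periodMeasure_eq (h : N.IsAllocation ς τ) :
    N.periodMeasure = volume.restrict (⋃ i, subPeriod ς τ i) := by
  rw [h.iUnion_subPeriod, periodMeasure]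

variable (N) in
lemma exists_isHovering (hς : ∀ k, 0 ≤ ς k) (hτ : ∀ ω, 0 ≤ τ ω) :
    ∃ s : Schedule K, N.IsHovering lam mu qbar ς τ s := by
  have : Nonempty (Decision K) := ⟨⟨0, 0, 0⟩⟩
  obtain ⟨d, hd⟩ := exists_eq_of_pairwise_disjoint (pairwise_disjoint_subPeriod hς hτ)
    (N.hover lam mu qbar)
  exact ⟨⟨fun i t => (d t).ρ i, fun k t => (d t).Q k, fun t => (d t).q⟩, isHovering_iff.2 hd⟩

lemma admissible_hover (i : Fin Ω ⊕ Fin K) : N.Admissible (N.hover lam mu qbar i).schedule := by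
  rcases i with ω | k
  · exact admissible_schedule rfl le_rfl
  · exact admissible_schedule rfl (Pi.single_nonneg.2 (N.power_nonneg _ _))

namespace IsHovering

variable {s : Schedule K} (hs : N.IsHovering lam mu qbar ς τ s) (ha : N.IsAllocation ς τ)

include hs ha

lemma admissible_schedule_decision {t : ℝ} (ht : t ∈ Set.Ioc 0 N.T) :
    N.Admissible (s.decision t).schedule := by
  obtain ⟨i, hi⟩ := Set.mem_iUnion.1 (ha.iUnion_subPeriod.ge ht)
  rw [isHovering_iff.1 hs i t hi]
  exact admissible_hover i

lemma aemeasurable_comp_decision {E : Type*} [MeasurableSpace E] (F : Decision K → E) :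
    AEMeasurable (fun t => F (s.decision t)) N.periodMeasure := by
  rw [ha.periodMeasure_eq]
  exact aemeasurable_iUnion_of_eq_const measurableSet_subPeriod fun i t ht =>
    congrArg F (isHovering_iff.1 hs i t ht)

lemma integrable_comp_decision (F : Decision K → ℝ) :
    Integrable (fun t => F (s.decision t)) N.periodMeasure := by
  rw [ha.periodMeasure_eq]
  exact integrableOn_finite_iUnion.2 <| integrableOn_of_eq_const measurableSet_subPeriod
    volume_subPeriod_ne_top fun i t ht => congrArg F (isHovering_iff.1 hs i t ht)

lemma admissible : N.Admissible s where
  binary j t ht := (hs.admissible_schedule_decision ha ht).binary j t ht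
  sum_eq_one t ht := (hs.admissible_schedule_decision ha ht).sum_eq_one t ht
  power_nonneg k t ht := (hs.admissible_schedule_decision ha ht).power_nonneg k t ht
  measurable_ρ j := hs.aemeasurable_comp_decision ha fun d => d.ρ j
  measurable_Q k := hs.aemeasurable_comp_decision ha fun d => d.Q k
  measurable_q := hs.aemeasurable_comp_decision ha Decision.q
  integrable k := hs.integrable_comp_decision ha fun d => d.ρ k.succ * d.Q k

lemma total_eq : N.total s = ∑ i, Sum.elim τ ς i • N.payoff (N.hover lam mu qbar i) := by
  ext j
  rw [(hs.admissible ha).total_eq_integral, ha.periodMeasure_eq,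
    integral_iUnion_of_eq_const measurableSet_subPeriod volume_subPeriod_ne_top
      (fun i t ht => congrArg (N.payoff · j) (isHovering_iff.1 hs i t ht))
      (pairwise_disjoint_subPeriod ha.ς_nonneg ha.τ_nonneg), Finset.sum_apply]
  simp only [volume_real_subPeriod ha.ς_nonneg ha.τ_nonneg, Pi.smul_apply, smul_eq_mul]

end IsHovering

lemma LPFeasible.epiFeasible {R : ℝ} (h : N.LPFeasible lam mu qbar ς τ R) {s : Schedule K}
    (hs : N.IsHovering lam mu qbar ς τ s) : N.EpiFeasible s R := by
  obtain ⟨ha, hle⟩ := lpFeasible_iff.1 h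
  exact epiFeasible_iff.2 ⟨hs.admissible ha, hle.trans_eq (hs.total_eq ha).symm⟩

lemma LPFeasible.le_of_isPriceBound {R V : ℝ} (h : N.LPFeasible lam mu qbar ς τ R)
    {lam' mu' : Fin K → ℝ} (hd : DualFeasible lam' mu') (hV : N.IsPriceBound lam' mu' V) :
    R ≤ N.T * V := by
  obtain ⟨s, hs⟩ := N.exists_isHovering (lam := lam) (mu := mu) (qbar := qbar)
    h.ς_nonneg h.τ_nonneg
  exact (h.epiFeasible hs).le_of_isPriceBound hd hV

end Hovering

lemma Feasible.epiFeasible_commonThroughput {s : Schedule K} (h : N.Feasible s) :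
    N.EpiFeasible s (N.commonThroughput s) :=
  ⟨h, fun k => ciInf_le (Set.finite_range _).bddBelow k⟩

lemma IsEpiOptimal.commonThroughput_eq [NeZero K] {s : Schedule K} {R : ℝ}
    (h : N.IsEpiOptimal s R) : N.commonThroughput s = R :=
  le_antisymm (h.2 s _ h.1.1.epiFeasible_commonThroughput) (le_ciInf h.1.2)

lemma IsEpiOptimal.isOptimal [NeZero K] {s : Schedule K} {R : ℝ} (h : N.IsEpiOptimal s R) :
    N.IsOptimal s :=
  ⟨h.1.1, fun s' hs' => (h.2 s' _ hs'.epiFeasible_commonThroughput).trans_eq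
    h.commonThroughput_eq.symm⟩

end Network

end UAV

theorem proposition3p3 {K : ℕ} (hK : 1 ≤ K) (N : UAV.Network K) :
    (∃ lam mu : Fin K → ℝ, N.IsDualOptimal lam mu) ∧
    ∀ lam mu : Fin K → ℝ, N.IsDualOptimal lam mu →
      (∀ k, 0 < mu k) ∧ (N.maximizers mu).Finite ∧ (N.maximizers mu).Nonempty ∧
      ∀ (Ω : ℕ) (qbar : Fin Ω → UAV.Plane),
        Function.Injective qbar → Set.range qbar = N.maximizers mu →
        (∃ (ς : Fin K → ℝ) (τ : Fin Ω → ℝ) (R : ℝ), N.IsLPOptimal lam mu qbar ς τ R) ∧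
        ∀ (ς : Fin K → ℝ) (τ : Fin Ω → ℝ) (R : ℝ), N.IsLPOptimal lam mu qbar ς τ R →
          (∃ s : UAV.Schedule K, N.IsHovering lam mu qbar ς τ s) ∧
          ∀ s : UAV.Schedule K, N.IsHovering lam mu qbar ς τ s →
            N.IsEpiOptimal s R ∧ N.IsOptimal s ∧ N.commonThroughput s = R := by
  have : NeZero K := ⟨by omega⟩
  refine ⟨N.exists_isDualOptimal, fun lam mu hopt => ?_⟩
  obtain ⟨V, hV⟩ := hopt.exists_isDualValue
  have hmu : ∀ k, 0 < mu k := hV.mu_pos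
  have hphi : 0 < N.phi 0 mu := N.phi_pos_of_forall_pos hmu 0
  refine ⟨hmu, N.maximizers_finite hphi, N.maximizers_nonempty hphi, fun Ω qbar _ hq => ?_⟩
  obtain ⟨ς₀, τ₀, h₀⟩ := hV.exists_lpFeasible hq.ge
  refine ⟨⟨ς₀, τ₀, N.T * V, h₀, fun ς τ R h =>
    h.le_of_isPriceBound hV.feasible hV.isPriceBound⟩, fun ς τ R hlp => ?_⟩
  refine ⟨N.exists_isHovering hlp.1.ς_nonneg hlp.1.τ_nonneg, fun s hs => ?_⟩
  have hepi : N.IsEpiOptimal s R := ⟨hlp.1.epiFeasible hs, fun s' R' h =>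
    (h.le_of_isPriceBound hV.feasible hV.isPriceBound).trans (hlp.2 _ _ _ h₀)⟩
  exact ⟨hepi, hepi.isOptimal, hepi.commonThroughput_eq⟩
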